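/- Let $p$ and $q$ be distinct primes with $p \equiv q \equiv 1 \pmod 3$, and for $n \ge 1$ let $\zeta_n = e^{2\pi i/n}$. Then the cyclotomic field $\mathbb{Q}(\zeta_{pq})$ contains exactly four subfields of degree $3$ over $\mathbb{Q}$. The fields $\mathbb{Q}(\zeta_p)$ and $\mathbb{Q}(\zeta_q)$ each contain exactly one cubic subfield, $K_1$ and $K_2$ respectively, and exactly two of the four cubic subfields of $\mathbb{Q}(\zeta_{pq})$ are contained in neither $\mathbb{Q}(\zeta_p)$ nor $\mathbb{Q}(\zeta_q)$. If $K$ is one of these two and its class number is $3$, then the Hilbert class field of $K$ (the largest abelian extension of $K$ in $\mathbb{C}$ that is unramified at all finite and infinite places of $K$) is the compositum $K_1K_2$; in particular, it is abelian over $\mathbb{Q}$. -/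

import Mathlib

open scoped NumberField

/-- The cyclotomic field `ℚ(ζ_n)`, as a subfield of `ℂ`, with `ζ_n = exp (2πi / n)`. -/
noncomputable def cyclotomicSubfield (n : ℕ) : IntermediateField ℚ ℂ :=
  IntermediateField.adjoin ℚ {Complex.exp (2 * Real.pi * Complex.I / n)}

/-- `K` is a subfield of `F` of degree `3` over `ℚ`. -/
def IsCubicSubfield (F K : IntermediateField ℚ ℂ) : Prop :=
  K ≤ F ∧ Module.finrank ℚ K = 3

/-- `L / K` is a finite abelian extension, unramified at all places of `K`, finite and infinite. -/
structure IsUnramifiedAbelianExtension (K L : Type*) [Field K] [Field L] [Algebra K L] : Prop where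
  finite : FiniteDimensional K L
  abelian : IsAbelianGalois K L
  unramified_finite : ∀ v : IsDedekindDomain.HeightOneSpectrum (𝓞 K),
    Algebra.IsUnramifiedIn (𝓞 L) v.asIdeal
  unramified_infinite : IsUnramifiedAtInfinitePlaces K L

/-- `H` is the Hilbert class field of `K` inside the algebraically closed field `Ω`: the largest
subextension of `Ω / K` that is abelian over `K` and unramified at all places of `K`.
It is unique by antisymmetry of inclusion. -/
def IsHilbertClassField (K : Type*) [Field K] [NumberField K] {Ω : Type*} [Field Ω]
    [IsAlgClosed Ω] [Algebra K Ω] (H : IntermediateField K Ω) : Prop :=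
  IsGreatest {L : IntermediateField K Ω | IsUnramifiedAbelianExtension K L} H

/-! Counting. The Galois group of `ℚ(ζ_pq)` is `(ℤ/p)ˣ × (ℤ/q)ˣ`, a product of two cyclic groups of
order divisible by 3. Its cubic characters are the `a ^ i * b ^ j`, with `a` and `b` coming from the
two factors. Up to inversion the nontrivial ones are `a`, `b`, `a * b` and `a * b⁻¹`, hence four
cubic fields. Any two of these four generate the other two, so `K K₁ = K K₂ = K₁ K₂`, of degree 9
over `ℚ` and 3 over `K`.

Ramification. A prime number `r` differs from `p` or from `q`, so inertia above `r` acts trivially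
on `K₁` or on `K₂`. Each of these generates `K₁ K₂` over `K`, so inertia over `K` is trivial. The
infinite places cause no trouble because the degree is odd.

Maximality (`isHilbertClassField_of_finrank_eq_classNumber`) needs no existence theorem of class
field theory. Let `M / K` be unramified everywhere, cyclic of prime degree `ℓ`. The Herbrand
quotient of the units (`units_herbrand`) gives `|Ĥ⁻¹| = ℓ |Ĥ⁰|`, and Hilbert 90 embeds `Ĥ⁻¹` into
the class group of `K`. This yields Hilbert's Theorem 94, so `ℓ ∣ h_K`. If moreover `h_K = ℓ`, then
`Ĥ⁰ = 0`, so every unit of `K` is the norm of a unit, and every ideal of `K` becomes principal in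
`M`. It follows that the trivial class is the only Galois-invariant class of `M`, and counting fixed
points gives `ℓ ∤ h_M`. For `L / K` unramified abelian, a prime dividing `[LM : M]` divides `h_K`,
so it is `ℓ`; by Theorem 94 over `M` it also divides `h_M`, a contradiction. Hence `L ≤ M`. -/

open scoped Pointwise nonZeroDivisors

/-! ### Multiplicativity of the quotient of cokernel and kernel orders -/

namespace AddMonoidHom

variable {A : Type*} [AddCommGroup A]

/-- The quotient of the orders of the cokernel and of the kernel of an endomorphism. -/
noncomputable def cokerDivKer (φ : A →+ A) : ℚ := φ.range.index / Nat.card φ.ker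

theorem card_ker_comp (φ ψ : A →+ A) :
    Nat.card (φ.comp ψ).ker = Nat.card ψ.ker * Nat.card (ψ.range ⊓ φ.ker : AddSubgroup A) := by
  have h1 : (φ.comp ψ).ker = φ.ker.comap ψ := by ext; simp [AddMonoidHom.mem_ker]
  have h2 : ψ.ker ≤ φ.ker.comap ψ := fun x hx => by
    simp [AddMonoidHom.mem_ker.mp hx]
  rw [h1, ← AddSubgroup.relIndex_bot_left,
    ← AddSubgroup.relIndex_mul_relIndex _ _ _ bot_le h2, AddSubgroup.relIndex_bot_left,
    AddSubgroup.relIndex_ker, AddSubgroup.map_comap_eq]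

theorem finite_ker_comp (φ ψ : A →+ A) [Finite φ.ker] [Finite ψ.ker] :
    Finite (φ.comp ψ).ker := by
  apply Nat.finite_of_card_ne_zero
  rw [card_ker_comp]
  have : Finite (ψ.range ⊓ φ.ker : AddSubgroup A) :=
    Finite.of_injective _ (AddSubgroup.inclusion_injective (inf_le_right : ψ.range ⊓ φ.ker ≤ φ.ker))
  exact mul_ne_zero Nat.card_pos.ne' Nat.card_pos.ne'

/-- This is the alternating product of orders in the exact sequence of kernels and cokernels of `ψ`,
`φ ∘ ψ` and `φ`. Cokernels may be infinite: their index is then 0 and the identities still hold. -/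
theorem cokerDivKer_comp (φ ψ : A →+ A) [Finite φ.ker] [Finite ψ.ker] :
    (φ.comp ψ).cokerDivKer = φ.cokerDivKer * ψ.cokerDivKer := by
  have := finite_ker_comp φ ψ
  have e1 : (φ.comp ψ).range.index = (ψ.range ⊔ φ.ker).index * φ.range.index := by
    rw [AddMonoidHom.range_comp, AddSubgroup.index_map]
  have e2 : ψ.range.relIndex φ.ker * (ψ.range ⊔ φ.ker).index = ψ.range.index := by
    rw [← AddSubgroup.relIndex_sup_left, AddSubgroup.relIndex_mul_index le_sup_left]
  have e3 : Nat.card (ψ.range ⊓ φ.ker : AddSubgroup A) * ψ.range.relIndex φ.ker =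
      Nat.card φ.ker := by
    rw [← AddSubgroup.inf_relIndex_right, ← AddSubgroup.relIndex_bot_left,
      AddSubgroup.relIndex_mul_relIndex _ _ _ bot_le inf_le_right, AddSubgroup.relIndex_bot_left]
  have e4 := card_ker_comp φ ψ
  have n1 : (Nat.card (φ.comp ψ).ker : ℚ) ≠ 0 := by exact_mod_cast Nat.card_pos.ne'
  have n2 : (Nat.card φ.ker : ℚ) ≠ 0 := by exact_mod_cast Nat.card_pos.ne'
  have n3 : (Nat.card ψ.ker : ℚ) ≠ 0 := by exact_mod_cast Nat.card_pos.ne'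
  rw [cokerDivKer, cokerDivKer, cokerDivKer, e1, ← e2, div_mul_div_comm, div_eq_div_iff n1
    (mul_ne_zero n2 n3), e4, ← e3]
  push_cast
  ring

theorem cokerDivKer_congr {φ ψ : A →+ A} (hk : φ.ker = ψ.ker) (hr : φ.range = ψ.range) :
    φ.cokerDivKer = ψ.cokerDivKer := by
  rw [cokerDivKer, cokerDivKer, hk, hr]

end AddMonoidHom

/-! ### Multiplication by an integer on a finitely generated abelian group -/

section FiniteRank

variable {A : Type*} [AddCommGroup A] [Module.Finite ℤ A]

theorem finite_ker_nsmul {n : ℕ} (hn : n ≠ 0) : Finite (nsmulAddMonoidHom (α := A) n).ker := by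
  let S : Submodule ℤ A := AddSubgroup.toIntSubmodule (nsmulAddMonoidHom (α := A) n).ker
  have hT : Module.IsTorsion ℤ S := by
    rintro ⟨x, hx⟩
    refine ⟨⟨(n : ℤ), mem_nonZeroDivisors_of_ne_zero (by exact_mod_cast hn)⟩, ?_⟩
    apply Subtype.ext
    have h : n • x = 0 := hx
    rw [Submonoid.smul_def, Submodule.coe_smul]
    simpa using h
  exact (Module.finite_of_fg_torsion S hT :)

/-- On the finite torsion subgroup `T` the kernel and cokernel of `n` have the same order and
cancel; the free quotient `A ⧸ T` contributes `n ^ rank`. Since `A ⧸ T` is torsion free, `nA ∩ T =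
nT`. -/
theorem cokerDivKer_nsmul {n : ℕ} (hn : n ≠ 0) :
    (nsmulAddMonoidHom (α := A) n).cokerDivKer = (n : ℚ) ^ Module.finrank ℤ A := by
  set T := Submodule.torsion ℤ A with hT
  set φ := nsmulAddMonoidHom (α := A) n with hφ
  have hfin := finite_ker_nsmul (A := A) hn
  have hTfin : Finite T := Module.finite_of_fg_torsion _ Submodule.torsion_isTorsion
  let π : A →+ A ⧸ T := T.mkQ.toAddMonoidHom
  have hπ : Function.Surjective π := T.mkQ_surjective
  have hπk : π.ker = T.toAddSubgroup := by
    ext x; simp [π, AddMonoidHom.mem_ker]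
  have e0 : (φ.range.map π) = (nsmulAddMonoidHom (α := A ⧸ T) n).range := by
    ext x
    constructor
    · rintro ⟨_, ⟨a, rfl⟩, rfl⟩
      exact ⟨π a, by simp [hφ]⟩
    · rintro ⟨a, rfl⟩
      obtain ⟨a, rfl⟩ := hπ a
      exact ⟨φ a, ⟨a, rfl⟩, by simp [hφ]⟩
  have hfr : Module.finrank ℤ (A ⧸ T) = Module.finrank ℤ A := by
    have := Submodule.finrank_quotient_add_finrank T
    have h0 : Module.finrank ℤ T = 0 := by
      rw [Module.finrank_eq_zero_iff_isTorsion]; exact Submodule.torsion_isTorsion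
    omega
  have e1 : (φ.range ⊔ T.toAddSubgroup).index = n ^ Module.finrank ℤ A := by
    have h := AddSubgroup.index_map φ.range π
    rw [e0, hπk, AddMonoidHom.range_eq_top_of_surjective _ hπ, AddSubgroup.index_top, mul_one] at h
    rw [← h, ← hfr]
    exact AddSubgroup.index_range_nsmul (A ⧸ T) n
  have e2 : φ.range.relIndex T.toAddSubgroup * (φ.range ⊔ T.toAddSubgroup).index =
      φ.range.index := by
    rw [← AddSubgroup.relIndex_sup_left, AddSubgroup.relIndex_mul_index le_sup_left]
  have e3 : Nat.card (φ.range ⊓ T.toAddSubgroup : AddSubgroup A) *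
      φ.range.relIndex T.toAddSubgroup = Nat.card T := by
    rw [← AddSubgroup.inf_relIndex_right, ← AddSubgroup.relIndex_bot_left,
      AddSubgroup.relIndex_mul_relIndex _ _ _ bot_le inf_le_right, AddSubgroup.relIndex_bot_left]
    rfl
  have hmem : ∀ a : A, n • a ∈ T → a ∈ T := by
    intro a ha
    rw [hT, Submodule.mem_torsion_iff] at ha ⊢
    obtain ⟨k, hk⟩ := ha
    refine ⟨k * ⟨(n : ℤ), mem_nonZeroDivisors_of_ne_zero (by exact_mod_cast hn)⟩, ?_⟩
    rw [mul_smul]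
    simpa [Submonoid.smul_def] using hk
  have e4 : Nat.card φ.ker * Nat.card (φ.range ⊓ T.toAddSubgroup : AddSubgroup A) =
      Nat.card T := by
    have hle : φ.ker ≤ T.toAddSubgroup := by
      intro x hx
      apply hmem
      have : n • x = 0 := hx
      rw [this]; exact T.zero_mem
    have hmap : T.toAddSubgroup.map φ = φ.range ⊓ T.toAddSubgroup := by
      ext x
      constructor
      · rintro ⟨a, ha, rfl⟩
        exact ⟨⟨a, rfl⟩, T.toAddSubgroup.nsmul_mem ha n⟩
      · rintro ⟨⟨a, rfl⟩, ha⟩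
        exact ⟨a, hmem a ha, rfl⟩
    rw [← hmap, ← AddSubgroup.relIndex_ker, ← AddSubgroup.relIndex_bot_left,
      AddSubgroup.relIndex_mul_relIndex _ _ _ bot_le hle, AddSubgroup.relIndex_bot_left]
    rfl
  have hpos : 0 < Nat.card (φ.range ⊓ T.toAddSubgroup : AddSubgroup A) := by
    apply Nat.pos_of_ne_zero
    intro h
    rw [h, mul_zero] at e4
    exact Nat.card_pos.ne e4
  have e5 : φ.range.relIndex T.toAddSubgroup = Nat.card φ.ker := by
    apply Nat.eq_of_mul_eq_mul_left hpos
    rw [e3, ← e4, mul_comm]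
  have n2 : (Nat.card φ.ker : ℚ) ≠ 0 := by exact_mod_cast Nat.card_pos.ne'
  rw [AddMonoidHom.cokerDivKer, ← e2, e1, e5]
  push_cast
  field_simp

end FiniteRank

/-! ### Herbrand quotient for a cyclic group of prime order -/

section CyclicAction

open Polynomial in
-- At a primitive `p`-th root of unity the product takes the value `p`, so the difference is
-- divisible by the minimal polynomial. Consequently `p = ∏ (1 - τ ^ i)` for every endomorphism `τ`
-- killed by the `p`-th cyclotomic polynomial.
theorem geom_sum_dvd_prod_one_sub_pow_sub (p : ℕ) [hp : Fact p.Prime] :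
    (∑ i ∈ Finset.range p, (X : ℤ[X]) ^ i) ∣
      (∏ i ∈ Finset.range (p - 1), (1 - X ^ (i + 1))) - (p : ℤ[X]) := by
  have hζ := Complex.isPrimitiveRoot_exp p hp.out.ne_zero
  rw [← cyclotomic_prime, cyclotomic_eq_minpoly hζ hp.out.pos]
  apply minpoly.isIntegrallyClosed_dvd (hζ.isIntegral hp.out.pos)
  obtain ⟨n, rfl⟩ : ∃ n, p = n + 1 := ⟨p - 1, by have := hp.out.pos; omega⟩
  have := hζ.prod_one_sub_pow_eq_order
  simp only [Nat.add_sub_cancel, map_sub, map_prod, map_one, map_pow, aeval_X, map_natCast]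
  rw [this]
  simp

variable {A : Type*} [AddCommGroup A]

local notation "ker⁺" φ:max => AddMonoidHom.ker (LinearMap.toAddMonoidHom φ)
local notation "range⁺" φ:max => AddMonoidHom.range (LinearMap.toAddMonoidHom φ)

theorem ker_one_sub_le_ker_one_sub_pow (τ : Module.End ℤ A) (j : ℕ) :
    ker⁺ (1 - τ) ≤ ker⁺ (1 - τ ^ j) := by
  intro x hx
  have hx : (1 - τ) x = 0 := hx
  change (1 - τ ^ j) x = 0
  rw [← geom_sum_mul_neg, Module.End.mul_apply, hx, map_zero]

theorem range_one_sub_pow_le_range_one_sub (τ : Module.End ℤ A) (j : ℕ) :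
    range⁺ (1 - τ ^ j) ≤ range⁺ (1 - τ) := by
  rintro _ ⟨x, rfl⟩
  refine ⟨(∑ i ∈ Finset.range j, τ ^ i) x, ?_⟩
  change (1 - τ) _ = (1 - τ ^ j) x
  rw [← mul_neg_geom_sum, Module.End.mul_apply]

theorem exists_pow_pow_eq {G : Type*} [Monoid G] {p : ℕ} (hp : p.Prime) {τ : G} (h : τ ^ p = 1)
    {j : ℕ} (hj0 : 0 < j) (hjp : j < p) : ∃ m, (τ ^ j) ^ m = τ := by
  have hc : j.Coprime p := (Nat.coprime_of_lt_prime hj0.ne' hjp hp).symm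
  obtain ⟨m, -, hm⟩ := Nat.exists_mul_mod_eq_one_of_coprime hc hp.one_lt
  refine ⟨m, ?_⟩
  have hd : orderOf τ ∣ p := orderOf_dvd_of_pow_eq_one h
  have h1 : j * m ≡ 1 [MOD p] := by
    rw [Nat.ModEq, hm, Nat.mod_eq_of_lt hp.one_lt]
  have h2 : j * m % orderOf τ = 1 % orderOf τ := h1.of_dvd hd
  rw [← pow_mul, ← pow_mod_orderOf, h2, pow_mod_orderOf, pow_one]

/-- Multiplication by `p` is the product of the `p - 1` factors `1 - τ ^ j`. Each of `τ` and `τ ^ j`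
is a power of the other, so all factors have the kernel and range of `1 - τ`, and multiplicativity
applies. -/
theorem cokerDivKer_one_sub_pow [Module.Finite ℤ A] {p : ℕ} [hp : Fact p.Prime]
    (τ : Module.End ℤ A) (hτ : ∑ i ∈ Finset.range p, τ ^ i = 0) :
    Finite (ker⁺ (1 - τ)) ∧
      (1 - τ).toAddMonoidHom.cokerDivKer ^ (p - 1) = (p : ℚ) ^ Module.finrank ℤ A := by
  have hp' := hp.out
  have hτp : τ ^ p = 1 := by
    have := mul_neg_geom_sum τ p
    rw [hτ, mul_zero] at this
    exact (sub_eq_zero.mp this.symm).symm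
  have hfin : Finite (ker⁺ (1 - τ)) := by
    have := finite_ker_nsmul (A := A) hp'.ne_zero
    have hle : ker⁺ (1 - τ) ≤ (nsmulAddMonoidHom (α := A) p).ker := by
      intro x hx
      have hx' : ∀ i, (τ ^ i) x = x := by
        intro i
        have : (1 - τ ^ i) x = 0 := ker_one_sub_le_ker_one_sub_pow τ i hx
        rw [LinearMap.sub_apply, sub_eq_zero] at this
        exact this.symm
      have h := DFunLike.congr_fun hτ x
      rw [LinearMap.sum_apply] at h
      simp only [hx', Finset.sum_const, Finset.card_range] at h
      exact h
    exact Finite.of_injective _ (AddSubgroup.inclusion_injective hle)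
  refine ⟨hfin, ?_⟩
  have hsame : ∀ j, 0 < j → j < p → ker⁺ (1 - τ ^ j) = ker⁺ (1 - τ) ∧
      range⁺ (1 - τ ^ j) = range⁺ (1 - τ) := by
    intro j h0 hj
    obtain ⟨m, hm⟩ := exists_pow_pow_eq hp' hτp h0 hj
    constructor
    · apply le_antisymm _ (ker_one_sub_le_ker_one_sub_pow τ j)
      have := ker_one_sub_le_ker_one_sub_pow (τ ^ j) m
      rwa [hm] at this
    · apply le_antisymm (range_one_sub_pow_le_range_one_sub τ j)
      have := range_one_sub_pow_le_range_one_sub (τ ^ j) m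
      rwa [hm] at this
  let P : ℕ → Polynomial ℤ := fun k => ∏ i ∈ Finset.range k, (1 - Polynomial.X ^ (i + 1))
  let φ : ℕ → Module.End ℤ A := fun k => Polynomial.aeval τ (P k)
  have hind : ∀ k, k ≤ p - 1 → Finite (ker⁺ (φ k)) ∧
      (φ k).toAddMonoidHom.cokerDivKer = (1 - τ).toAddMonoidHom.cokerDivKer ^ k := by
    intro k
    induction k with
    | zero =>
      intro _
      have h1 : (φ 0).toAddMonoidHom = AddMonoidHom.id A := by
        have : φ 0 = 1 := by simp [φ, P]
        rw [this]; rfl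
      have hr : (AddMonoidHom.id A).range = ⊤ := by ext x; simp
      rw [h1, AddMonoidHom.cokerDivKer, AddMonoidHom.ker_id, hr]
      exact ⟨inferInstance, by simp⟩
    | succ k ih =>
      intro hk
      obtain ⟨ih1, ih2⟩ := ih (by omega)
      have h1 : (φ (k + 1)).toAddMonoidHom =
          (φ k).toAddMonoidHom.comp (1 - τ ^ (k + 1)).toAddMonoidHom := by
        have : φ (k + 1) = φ k * (1 - τ ^ (k + 1)) := by
          simp only [φ, P, Finset.prod_range_succ, map_mul, map_sub, map_one, map_pow,
            Polynomial.aeval_X]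
        rw [this]; rfl
      obtain ⟨s1, s2⟩ := hsame (k + 1) (by omega) (by omega)
      have hf : Finite (ker⁺ (1 - τ ^ (k + 1))) := by rw [s1]; exact hfin
      rw [h1]
      refine ⟨AddMonoidHom.finite_ker_comp _ _, ?_⟩
      rw [AddMonoidHom.cokerDivKer_comp, ih2, AddMonoidHom.cokerDivKer_congr s1 s2, pow_succ]
  rw [← (hind (p - 1) le_rfl).2]
  have hlast : (φ (p - 1)).toAddMonoidHom = nsmulAddMonoidHom (α := A) p := by
    obtain ⟨c, hc⟩ := geom_sum_dvd_prod_one_sub_pow_sub p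
    have := congrArg (Polynomial.aeval τ) hc
    rw [map_mul, map_sum] at this
    simp only [map_pow, Polynomial.aeval_X] at this
    rw [hτ, zero_mul, map_sub, sub_eq_zero] at this
    simp only [φ, P]
    rw [this]
    ext x
    simp
  rw [hlast, cokerDivKer_nsmul hp'.ne_zero]

/-- In the chain `f (ker g) ≤ range f ≤ ker g`, the lower quotient is `A ⧸ (ker g + ker f)` through
`f`. This factor is symmetric in `f` and `g`, so it drops out when the two orders are compared. -/
theorem relIndex_map_ker_eq (f g : Module.End ℤ A) (h : range⁺ f ≤ ker⁺ g) :
    ((ker⁺ g).map f.toAddMonoidHom).relIndex (ker⁺ g) =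
      (ker⁺ g ⊔ ker⁺ f).index * (range⁺ f).relIndex (ker⁺ g) := by
  have h1 : (ker⁺ g).map f.toAddMonoidHom ≤ range⁺ f := AddSubgroup.map_le_range _ _
  rw [← AddSubgroup.relIndex_mul_relIndex _ _ _ h1 h]
  congr 1
  rw [AddMonoidHom.range_eq_map, AddSubgroup.relIndex_map_map]
  simp

theorem LinearMap.finrank_range_add_finrank_ker_int {A B : Type*} [AddCommGroup A] [AddCommGroup B]
    [Module.Finite ℤ A] (f : A →ₗ[ℤ] B) : Module.finrank ℤ (LinearMap.range f) +
      Module.finrank ℤ (LinearMap.ker f) = Module.finrank ℤ A := by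
  rw [← Submodule.finrank_quotient_add_finrank (LinearMap.ker f),
    f.quotKerEquivRange.finrank_eq]

theorem AddSubgroup.relIndex_map_range_of_injective {A B : Type*} [AddCommGroup A] [AddCommGroup B]
    {ι : B →+ A} (hι : Function.Injective ι) (H : AddSubgroup B) :
    (H.map ι).relIndex ι.range = H.index := by
  rw [AddMonoidHom.range_eq_map, AddSubgroup.relIndex_map_map_of_injective _ _ hι,
    AddSubgroup.relIndex_top_right]

/-- The Herbrand quotient of a finitely generated module over a cyclic group of prime order `p`,
in the case `rank A + 1 = p * (rank A ^ G + 1)`. -/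
theorem relIndex_range_one_sub_eq_mul [Module.Finite ℤ A] {p : ℕ} [hp : Fact p.Prime]
    (σ g : Module.End ℤ A) (hσ : σ ^ p = 1) (hg : g = ∑ i ∈ Finset.range p, σ ^ i)
    (hrank : Module.finrank ℤ A + 1 = p * (Module.finrank ℤ (LinearMap.ker (1 - σ)) + 1)) :
    (range⁺ g).relIndex (ker⁺ (1 - σ)) ≠ 0 ∧
    (range⁺ (1 - σ)).relIndex (ker⁺ g) = p * (range⁺ g).relIndex (ker⁺ (1 - σ)) := by
  have hp' := hp.out
  have hfg : (1 - σ) * g = 0 := by rw [hg, mul_neg_geom_sum, hσ, sub_self]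
  have hgf : g * (1 - σ) = 0 := by rw [hg, geom_sum_mul_neg, hσ, sub_self]
  have h1 : range⁺ (1 - σ) ≤ ker⁺ g := by
    rintro _ ⟨x, rfl⟩
    exact DFunLike.congr_fun hgf x
  have h2 : range⁺ g ≤ ker⁺ (1 - σ) := by
    rintro _ ⟨x, rfl⟩
    exact DFunLike.congr_fun hfg x
  have hcomm : σ * g = g * σ := by
    rw [sub_mul, one_mul, sub_eq_zero] at hfg
    rw [mul_sub, mul_one, sub_eq_zero] at hgf
    rw [← hfg, ← hgf]
  -- Both identities contain the index of `ker g ⊔ ker (1 - σ)`. It remains to compare `1 - σ` on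
  -- `ker g` with `g`, that is with `p`, on `ker (1 - σ)`.
  have e1 := relIndex_map_ker_eq (1 - σ) g h1
  have e2 := relIndex_map_ker_eq g (1 - σ) h2
  -- on `ker (1 - σ)` the map `g` is multiplication by `p`
  have hgp : ∀ x ∈ ker⁺ (1 - σ), g x = p • x := by
    intro x hx
    have hx' : ∀ i, (σ ^ i) x = x := by
      intro i
      have : (1 - σ ^ i) x = 0 := ker_one_sub_le_ker_one_sub_pow σ i hx
      rw [LinearMap.sub_apply, sub_eq_zero] at this
      exact this.symm
    rw [hg, LinearMap.sum_apply]
    simp [hx']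
  let C := LinearMap.ker (1 - σ)
  let B := LinearMap.ker g
  have hBσ : ∀ x ∈ B, σ x ∈ B := by
    intro x hx
    rw [LinearMap.mem_ker] at hx ⊢
    rw [← Module.End.mul_apply, ← hcomm, Module.End.mul_apply, hx, map_zero]
  let τ : Module.End ℤ B := σ.restrict hBσ
  have hτi : ∀ (i : ℕ) (x : B), (((τ ^ i) x : B) : A) = (σ ^ i) x := by
    intro i
    induction i with
    | zero => intro x; simp
    | succ i ih =>
      intro x
      rw [pow_succ', pow_succ', Module.End.mul_apply, Module.End.mul_apply, ← ih]
      rfl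
  have hτ : ∑ i ∈ Finset.range p, τ ^ i = 0 := by
    ext x
    rw [LinearMap.sum_apply, AddSubmonoidClass.coe_finsetSum]
    simp only [hτi]
    rw [← LinearMap.sum_apply, ← hg, LinearMap.mem_ker.mp x.2]
    rfl
  obtain ⟨hfin, hchi⟩ := cokerDivKer_one_sub_pow τ hτ
  have hchi' := cokerDivKer_nsmul (A := C) hp'.ne_zero
  have hfin' := finite_ker_nsmul (A := C) hp'.ne_zero
  let ιB : B →+ A := B.subtype.toAddMonoidHom
  let ιC : C →+ A := C.subtype.toAddMonoidHom
  have hιB : Function.Injective ιB := Subtype.val_injective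
  have hιC : Function.Injective ιC := Subtype.val_injective
  have hBr : ιB.range = ker⁺ g := by
    ext x
    exact ⟨by rintro ⟨y, rfl⟩; exact y.2, fun hx => ⟨⟨x, hx⟩, rfl⟩⟩
  have hCr : ιC.range = ker⁺ (1 - σ) := by
    ext x
    exact ⟨by rintro ⟨y, rfl⟩; exact y.2, fun hx => ⟨⟨x, hx⟩, rfl⟩⟩
  have i1 : ((ker⁺ g).map (1 - σ).toAddMonoidHom).relIndex (ker⁺ g) = (range⁺ (1 - τ)).index := by
    rw [← AddSubgroup.relIndex_map_range_of_injective hιB, hBr]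
    congr 1
    ext x
    constructor
    · rintro ⟨y, hy, rfl⟩
      exact ⟨(1 - τ) ⟨y, hy⟩, ⟨_, rfl⟩, rfl⟩
    · rintro ⟨_, ⟨y, rfl⟩, rfl⟩
      exact ⟨y, y.2, rfl⟩
  have i2 : ((ker⁺ (1 - σ)).map g.toAddMonoidHom).relIndex (ker⁺ (1 - σ)) =
      (nsmulAddMonoidHom (α := C) p).range.index := by
    rw [← AddSubgroup.relIndex_map_range_of_injective hιC, hCr]
    congr 1
    ext x
    constructor
    · rintro ⟨y, hy, rfl⟩
      exact ⟨p • ⟨y, hy⟩, ⟨_, rfl⟩, (hgp y hy).symm⟩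
    · rintro ⟨_, ⟨y, rfl⟩, rfl⟩
      exact ⟨y, y.2, hgp y y.2⟩
  -- Both kernels consist of the `x` in `A` with `σ x = x` and `p • x = 0`.
  have hk : Nat.card (ker⁺ (1 - τ)) = Nat.card (nsmulAddMonoidHom (α := C) p).ker := by
    rw [← AddSubgroup.card_map_of_injective hιB, ← AddSubgroup.card_map_of_injective hιC]
    congr 2
    ext x
    constructor
    · rintro ⟨y, hy, rfl⟩
      have hy1 : (y : A) ∈ ker⁺ (1 - σ) := congrArg Subtype.val (hy : (1 - τ) y = 0)
      refine ⟨⟨y, hy1⟩, Subtype.ext ?_, rfl⟩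
      exact (hgp y hy1).symm.trans (LinearMap.mem_ker.mp y.2)
    · rintro ⟨y, hy, rfl⟩
      have hy1 : g (y : A) = 0 :=
        (hgp y y.2).trans (congrArg Subtype.val (hy : p • y = 0))
      refine ⟨⟨y, hy1⟩, Subtype.ext ?_, rfl⟩
      exact LinearMap.mem_ker.mp y.2
  -- The range of `g` lies in `C`, and `g` restricted to `C` is multiplication by `p`, whose kernel
  -- is torsion; so the range has the full rank of `C`.
  have hrk : Module.finrank ℤ B + Module.finrank ℤ C = Module.finrank ℤ A := by
    have r1 := LinearMap.finrank_range_add_finrank_ker_int g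
    have r2 : Module.finrank ℤ (LinearMap.range g) ≤ Module.finrank ℤ C :=
      Submodule.finrank_mono h2
    have r3 := LinearMap.finrank_range_add_finrank_ker_int (g.domRestrict C)
    have r4 : Module.finrank ℤ (LinearMap.range (g.domRestrict C)) ≤
        Module.finrank ℤ (LinearMap.range g) := by
      apply Submodule.finrank_mono
      rintro _ ⟨x, rfl⟩
      exact ⟨x, rfl⟩
    have r5 : Module.finrank ℤ (LinearMap.ker (g.domRestrict C)) = 0 := by
      rw [Module.finrank_eq_zero_iff_isTorsion]
      rintro ⟨x, hx⟩
      refine ⟨⟨(p : ℤ), mem_nonZeroDivisors_of_ne_zero (by exact_mod_cast hp'.ne_zero)⟩, ?_⟩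
      apply Subtype.ext
      apply Subtype.ext
      have h : p • (x : A) = 0 := (hgp x x.2).symm.trans hx
      rw [Submonoid.smul_def, Submodule.coe_smul, Submodule.coe_smul]
      simpa using h
    change _ + Module.finrank ℤ B = _ at r1
    omega
  -- With `c = rank C`, the `(p - 1)`-th root of `p ^ rank B` is `p ^ (c + 1)`, whereas
  -- multiplication by `p` on `C` gives `p ^ c`. The excess is the factor `p` of the conclusion.
  have hrkB : Module.finrank ℤ B = (Module.finrank ℤ C + 1) * (p - 1) := by
    obtain ⟨n, hn⟩ : ∃ n, p = n + 1 := ⟨p - 1, by have := hp'.pos; omega⟩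
    have : Module.finrank ℤ A + 1 = p * (Module.finrank ℤ C + 1) := hrank
    rw [hn] at this
    rw [hn, Nat.add_sub_cancel]
    nlinarith
  rw [hrkB, pow_mul] at hchi
  have hchi2 : (1 - τ).toAddMonoidHom.cokerDivKer = (p : ℚ) ^ (Module.finrank ℤ C + 1) := by
    refine (pow_left_inj₀ ?_ (by positivity) (by have := hp'.two_le; omega)).mp hchi
    rw [AddMonoidHom.cokerDivKer]
    positivity
  have nk : (Nat.card (nsmulAddMonoidHom (α := C) p).ker : ℚ) ≠ 0 := by
    exact_mod_cast Nat.card_pos.ne'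
  have hp0 : (p : ℚ) ≠ 0 := by exact_mod_cast hp'.ne_zero
  rw [AddMonoidHom.cokerDivKer, hk, div_eq_iff nk, ← i1, e1] at hchi2
  rw [AddMonoidHom.cokerDivKer, div_eq_iff nk, ← i2, e2] at hchi'
  rw [sup_comm] at hchi'
  have hne : ((ker⁺ g ⊔ ker⁺ (1 - σ)).index : ℚ) *
      ((range⁺ g).relIndex (ker⁺ (1 - σ)) : ℚ) ≠ 0 := by
    rw [← Nat.cast_mul, hchi']
    exact mul_ne_zero (pow_ne_zero _ hp0) nk
  refine ⟨by exact_mod_cast right_ne_zero_of_mul hne, ?_⟩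
  have : (((range⁺ (1 - σ)).relIndex (ker⁺ g) : ℕ) : ℚ) =
      ((p * (range⁺ g).relIndex (ker⁺ (1 - σ)) : ℕ) : ℚ) := by
    apply mul_left_cancel₀ (left_ne_zero_of_mul hne)
    rw [← Nat.cast_mul, hchi2, pow_succ, Nat.cast_mul, mul_left_comm, ← Nat.cast_mul, hchi']
    ring
  exact_mod_cast this

end CyclicAction

/-! ### Units of the ring of integers as a Galois module -/

section GaloisUnits

variable {K L : Type*} [Field K] [Field L] [Algebra K L]

/-- The action of an automorphism on the units of the ring of integers, written additively. -/
noncomputable def galUnitsEnd (σ : Gal(L/K)) : Module.End ℤ (Additive (𝓞 L)ˣ) :=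
  (MonoidHom.toAdditive (Units.map (MulDistribMulAction.toMonoidHom (𝓞 L) σ))).toIntLinearMap

theorem coe_galUnitsEnd_apply (σ : Gal(L/K)) (u : Additive (𝓞 L)ˣ) :
    ((galUnitsEnd σ u).toMul : 𝓞 L) = σ • (u.toMul : 𝓞 L) := rfl

theorem galUnitsEnd_one : galUnitsEnd (1 : Gal(L/K)) = 1 := by
  refine LinearMap.ext fun u => ?_
  apply Additive.toMul.injective
  apply Units.ext
  rw [coe_galUnitsEnd_apply, one_smul]
  rfl

theorem galUnitsEnd_mul (σ τ : Gal(L/K)) :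
    galUnitsEnd (σ * τ) = galUnitsEnd σ * galUnitsEnd τ := by
  refine LinearMap.ext fun u => ?_
  apply Additive.toMul.injective
  apply Units.ext
  rw [coe_galUnitsEnd_apply, mul_smul]
  rfl

theorem galUnitsEnd_pow (σ : Gal(L/K)) (n : ℕ) : galUnitsEnd (σ ^ n) = galUnitsEnd σ ^ n := by
  induction n with
  | zero => simp [galUnitsEnd_one]
  | succ n ih => rw [pow_succ, galUnitsEnd_mul, ih, pow_succ]

theorem mem_ker_one_sub_galUnitsEnd {σ : Gal(L/K)} {u : Additive (𝓞 L)ˣ} :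
    (1 - galUnitsEnd σ) u = 0 ↔ σ • (u.toMul : 𝓞 L) = u.toMul := by
  rw [LinearMap.sub_apply, sub_eq_zero, ← coe_galUnitsEnd_apply, eq_comm]
  constructor
  · intro h
    rw [h]; rfl
  · intro h
    exact Additive.toMul.injective (Units.ext h)

theorem coe_sum_galUnitsEnd (σ : Gal(L/K)) (n : ℕ) (u : Additive (𝓞 L)ˣ) :
    (((∑ i ∈ Finset.range n, galUnitsEnd σ ^ i) u).toMul : 𝓞 L) =
      ∏ i ∈ Finset.range n, σ ^ i • (u.toMul : 𝓞 L) := by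
  rw [LinearMap.sum_apply, toMul_sum, Units.coe_prod]
  refine Finset.prod_congr rfl fun i _ => ?_
  rw [← galUnitsEnd_pow, coe_galUnitsEnd_apply]

theorem RingOfIntegers.coe_gal_smul (σ : Gal(L/K)) (x : 𝓞 L) : ((σ • x : 𝓞 L) : L) = σ (x : L) :=
  rfl

theorem prod_range_pow_eq_prod_gal [FiniteDimensional K L] [IsGalois K L] {σ : Gal(L/K)}
    (hσ : ∀ τ, τ ∈ Subgroup.zpowers σ) {M : Type*} [CommMonoid M] (F : Gal(L/K) → M) :
    ∏ i ∈ Finset.range (Module.finrank K L), F (σ ^ i) = ∏ τ : Gal(L/K), F τ := by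
  classical
  have hcard : orderOf σ = Module.finrank K L := by
    rw [← IsGalois.card_aut_eq_finrank, orderOf_eq_card_of_forall_mem_zpowers hσ]
  rw [← hcard]
  refine Finset.prod_bij (fun i _ => σ ^ i) (fun _ _ => Finset.mem_univ _) ?_ ?_ (fun _ _ => rfl)
  · intro i hi j hj h
    exact pow_injOn_Iio_orderOf (by simpa using hi) (by simpa using hj) h
  · intro τ _
    obtain ⟨i, hi, h⟩ := (mem_zpowers_iff_mem_range_orderOf.mp (hσ τ) |> Finset.mem_image.mp)
    exact ⟨i, hi, h⟩

theorem algebraMap_norm_eq_prod_range [FiniteDimensional K L] [IsGalois K L] {σ : Gal(L/K)}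
    (hσ : ∀ τ, τ ∈ Subgroup.zpowers σ) (x : L) :
    algebraMap K L (Algebra.norm K x) = ∏ i ∈ Finset.range (Module.finrank K L), (σ ^ i) x := by
  rw [Algebra.norm_eq_prod_automorphisms, prod_range_pow_eq_prod_gal hσ (fun τ => τ x)]

theorem smul_eq_of_generator_smul_eq {G X : Type*} [Group G] [MulAction G X] {σ : G}
    (hσ : ∀ τ, τ ∈ Subgroup.zpowers σ) {x : X} (h : σ • x = x) (τ : G) : τ • x = x := by
  have : Subgroup.zpowers σ ≤ MulAction.stabilizer G x := by
    rw [Subgroup.zpowers_le]; exact h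
  exact this (hσ τ)

variable [NumberField K] [NumberField L] [IsGalois K L]

theorem exists_algebraMap_eq_of_smul_eq {σ : Gal(L/K)} (hσ : ∀ τ, τ ∈ Subgroup.zpowers σ)
    {x : 𝓞 L} (h : σ • x = x) : ∃ y : 𝓞 K, algebraMap (𝓞 K) (𝓞 L) y = x :=
  Algebra.IsInvariant.isInvariant (G := Gal(L/K)) x (smul_eq_of_generator_smul_eq hσ h)

theorem exists_units_map_eq_of_smul_eq {σ : Gal(L/K)} (hσ : ∀ τ, τ ∈ Subgroup.zpowers σ)
    {u : (𝓞 L)ˣ} (h : σ • (u : 𝓞 L) = u) :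
    ∃ v : (𝓞 K)ˣ, algebraMap (𝓞 K) (𝓞 L) v = u := by
  obtain ⟨y, hy⟩ := exists_algebraMap_eq_of_smul_eq hσ h
  have h' : σ • ((u⁻¹ : (𝓞 L)ˣ) : 𝓞 L) = (u⁻¹ : (𝓞 L)ˣ) := by
    apply u.isUnit.mul_left_cancel
    nth_rewrite 1 [← h]
    rw [← smul_mul', Units.mul_inv, smul_one]
  obtain ⟨z, hz⟩ := exists_algebraMap_eq_of_smul_eq hσ h'
  have hyz : y * z = 1 := by
    apply FaithfulSMul.algebraMap_injective (𝓞 K) (𝓞 L)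
    rw [map_mul, hy, hz, Units.mul_inv, map_one]
  exact ⟨⟨y, z, hyz, by rw [mul_comm, hyz]⟩, hy⟩

theorem finrank_ker_one_sub_galUnitsEnd {σ : Gal(L/K)} (hσ : ∀ τ, τ ∈ Subgroup.zpowers σ) :
    Module.finrank ℤ (LinearMap.ker (1 - galUnitsEnd σ)) = NumberField.Units.rank K := by
  rw [← NumberField.Units.finrank_eq]
  let ι : Additive (𝓞 K)ˣ →ₗ[ℤ] Additive (𝓞 L)ˣ :=
    (MonoidHom.toAdditive (Units.map (algebraMap (𝓞 K) (𝓞 L) : 𝓞 K →* 𝓞 L))).toIntLinearMap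
  have hι : Function.Injective ι := by
    intro x y h
    have h' := congrArg (fun z : Additive (𝓞 L)ˣ => (z.toMul : 𝓞 L)) h
    apply Additive.toMul.injective
    apply Units.ext
    exact FaithfulSMul.algebraMap_injective (𝓞 K) (𝓞 L) h'
  have hr : LinearMap.range ι = LinearMap.ker (1 - galUnitsEnd σ) := by
    ext u
    rw [LinearMap.mem_ker, mem_ker_one_sub_galUnitsEnd]
    constructor
    · rintro ⟨v, rfl⟩
      exact smul_algebraMap σ (v.toMul : 𝓞 K)
    · intro h
      obtain ⟨v, hv⟩ := exists_units_map_eq_of_smul_eq hσ h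
      exact ⟨Additive.ofMul v, Additive.toMul.injective (Units.ext hv)⟩
  rw [← hr]
  exact (LinearEquiv.ofInjective ι hι).finrank_eq.symm

/-- Without ramification at infinity, `L` has `p` times as many infinite places as `K`. As the unit
rank is one less than the number of these places, the rank condition of
`relIndex_range_one_sub_eq_mul` holds. The relative indices are the orders of `Ĥ⁻¹` and `Ĥ⁰`; the
value 0 would mean infinite. -/
theorem units_herbrand [IsUnramifiedAtInfinitePlaces K L] {p : ℕ} [hp : Fact p.Prime]
    (hKL : Module.finrank K L = p) {σ : Gal(L/K)} (hσ : ∀ τ, τ ∈ Subgroup.zpowers σ)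
    (g : Module.End ℤ (Additive (𝓞 L)ˣ)) (hg : g = ∑ i ∈ Finset.range p, galUnitsEnd σ ^ i) :
    g.toAddMonoidHom.range.relIndex (1 - galUnitsEnd σ).toAddMonoidHom.ker ≠ 0 ∧
    (1 - galUnitsEnd σ).toAddMonoidHom.range.relIndex g.toAddMonoidHom.ker =
      p * g.toAddMonoidHom.range.relIndex (1 - galUnitsEnd σ).toAddMonoidHom.ker := by
  have hcard : orderOf σ = p := by
    rw [← hKL, ← IsGalois.card_aut_eq_finrank, orderOf_eq_card_of_forall_mem_zpowers hσ]
  apply relIndex_range_one_sub_eq_mul _ _ _ hg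
  · rw [finrank_ker_one_sub_galUnitsEnd hσ, NumberField.Units.finrank_eq, NumberField.Units.rank,
      NumberField.Units.rank, IsUnramifiedAtInfinitePlaces.card_infinitePlace K L, hKL]
    have h1 : 0 < Fintype.card (NumberField.InfinitePlace K) := Fintype.card_pos
    have h2 := Nat.mul_pos h1 hp.out.pos
    rw [Nat.sub_add_cancel h1, Nat.sub_add_cancel h2, mul_comm]
  · rw [← galUnitsEnd_pow, ← hcard, pow_orderOf_eq_one, galUnitsEnd_one]

end GaloisUnits

/-! ### Galois-invariant ideals and Hilbert 90 -/

section InvariantIdeals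

variable {K L : Type*} [Field K] [Field L] [Algebra K L] [NumberField K] [NumberField L]
  [IsGalois K L]

/-- Being unramified, the extended prime is the product of the distinct primes above it. These are
the conjugates of `Q`, and each divides the invariant ideal `I`. -/
theorem map_dvd_of_prime_dvd_of_gal_smul_eq
    (hunr : ∀ v : IsDedekindDomain.HeightOneSpectrum (𝓞 K),
      Algebra.IsUnramifiedIn (𝓞 L) v.asIdeal)
    {I Q : Ideal (𝓞 L)} (hI : ∀ σ : Gal(L/K), σ • I = I) (hQ : Q.IsPrime) (hQ0 : Q ≠ ⊥)
    (hQI : Q ∣ I) : (Q.under (𝓞 K)).map (algebraMap (𝓞 K) (𝓞 L)) ∣ I := by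
  have hP0 : Q.under (𝓞 K) ≠ ⊥ := Ideal.under_ne_bot (𝓞 K) hQ0
  have hPp : (Q.under (𝓞 K)).IsPrime := hQ.under (𝓞 K)
  have hPm : (Q.under (𝓞 K)).IsMaximal := hPp.isMaximal hP0
  rw [Ideal.map_algebraMap_eq_finsetProd_pow hP0]
  have hmem : ∀ P ∈ ((Q.under (𝓞 K)).primesOver (𝓞 L)).toFinset, P.IsPrime ∧ P ≠ ⊥ ∧
      P.LiesOver (Q.under (𝓞 K)) := by
    intro P hP
    rw [Set.mem_toFinset] at hP
    obtain ⟨h1, h2⟩ := hP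
    exact ⟨h1, Ideal.ne_bot_of_liesOver_of_ne_bot hP0 P, h2⟩
  have he : ∏ P ∈ ((Q.under (𝓞 K)).primesOver (𝓞 L)).toFinset, P ^ P.ramificationIdx (𝓞 K) =
      ∏ P ∈ ((Q.under (𝓞 K)).primesOver (𝓞 L)).toFinset, P := by
    refine Finset.prod_congr rfl fun P hP => ?_
    obtain ⟨h1, -, h2⟩ := hmem P hP
    rw [Algebra.IsUnramifiedIn.ramificationIdx_eq_one
      (hunr ⟨Q.under (𝓞 K), hPp, hP0⟩) h2, pow_one]
  rw [he]
  apply Finset.prod_primes_dvd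
  · intro P hP
    obtain ⟨h1, h0, -⟩ := hmem P hP
    exact Ideal.prime_of_isPrime h0 h1
  · intro P hP
    obtain ⟨h1, -, h2⟩ := hmem P hP
    obtain ⟨σ, rfl⟩ := Ideal.exists_smul_eq_of_isGaloisGroup (Q.under (𝓞 K)) Q P Gal(L/K)
    obtain ⟨J, rfl⟩ := hQI
    refine ⟨σ • J, ?_⟩
    rw [← smul_mul', hI σ]

theorem exists_map_eq_of_gal_smul_eq
    (hunr : ∀ v : IsDedekindDomain.HeightOneSpectrum (𝓞 K),
      Algebra.IsUnramifiedIn (𝓞 L) v.asIdeal)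
    (I : Ideal (𝓞 L)) (hI0 : I ≠ ⊥) (hI : ∀ σ : Gal(L/K), σ • I = I) :
    ∃ J : Ideal (𝓞 K), J.map (algebraMap (𝓞 K) (𝓞 L)) = I := by
  induction I using WellFoundedGT.induction with
  | ind I ih =>
    by_cases htop : I = ⊤
    · exact ⟨⊤, by rw [Ideal.map_top, htop]⟩
    obtain ⟨Q, hQm, hQI⟩ := Ideal.exists_le_maximal I htop
    have hQ0 : Q ≠ ⊥ := fun h => hI0 (le_bot_iff.mp (h ▸ hQI))
    obtain ⟨I', hI'⟩ := map_dvd_of_prime_dvd_of_gal_smul_eq hunr hI hQm.isPrime hQ0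
      (Ideal.dvd_iff_le.mpr hQI)
    set P := Q.under (𝓞 K) with hP
    have hPQ : P.map (algebraMap (𝓞 K) (𝓞 L)) ≤ Q := Ideal.map_comap_le
    have hP0 : P.map (algebraMap (𝓞 K) (𝓞 L)) ≠ ⊥ := by
      intro h; rw [h, Ideal.bot_mul] at hI'; exact hI0 hI'
    have hI'0 : I' ≠ ⊥ := by
      intro h; rw [h, Ideal.mul_bot] at hI'; exact hI0 hI'
    -- Removing the extended prime strictly enlarges the ideal, so the induction on ideals ordered
    -- by `>` proceeds.
    have hlt : I < I' := by
      refine lt_of_le_of_ne (hI'.trans_le Ideal.mul_le_right) fun h => ?_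
      have h1 : P.map (algebraMap (𝓞 K) (𝓞 L)) * I' = 1 * I' := by rw [← hI', one_mul, h]
      have h2 := mul_right_cancel₀ (b := I') hI'0 h1
      rw [h2, Ideal.one_eq_top, top_le_iff] at hPQ
      exact hQm.ne_top hPQ
    have hsP : ∀ σ : Gal(L/K), σ • P.map (algebraMap (𝓞 K) (𝓞 L)) =
        P.map (algebraMap (𝓞 K) (𝓞 L)) := by
      intro σ
      rw [Ideal.pointwise_smul_def, Ideal.map_map]
      congr 1
      ext x
      exact congrArg _ (smul_algebraMap σ x)
    obtain ⟨J, hJ⟩ := ih I' hlt hI'0 (by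
      intro σ
      have h := hI σ
      rw [hI', smul_mul', hsP] at h
      exact mul_left_cancel₀ hP0 h)
    exact ⟨P * J, by rw [Ideal.map_mul, hJ, hI']⟩

/-- Hilbert 90, with the denominator cleared by a rational integer, which `σ` fixes. -/
theorem exists_integral_mul_gal_eq {K L : Type} [Field K] [Field L] [Algebra K L] [NumberField L]
    [FiniteDimensional K L] [IsGalois K L] {σ : Gal(L/K)} (hσ : ∀ τ, τ ∈ Subgroup.zpowers σ)
    {x : L} (hx : Algebra.norm K x = 1) :
    ∃ w : 𝓞 L, w ≠ 0 ∧ x * ((σ • w : 𝓞 L) : L) = w := by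
  have : IsCyclic Gal(L/K) := ⟨σ, hσ⟩
  obtain ⟨y, hy⟩ := groupCohomology.exists_div_of_norm_eq_one hσ hx
  obtain ⟨t, ht0, ht⟩ : ∃ t : ℤ, t ≠ 0 ∧ IsIntegral ℤ (t • (y : L)) := by
    exact ((IsFractionRing.isAlgebraic_iff ℤ ℚ L).mpr
      (Algebra.IsAlgebraic.isAlgebraic (R := ℚ) (y : L))).exists_integral_multiple
  have hy0 : (y : L) ≠ 0 := y.ne_zero
  obtain ⟨w, hw⟩ : ∃ w : 𝓞 L, (w : L) = t • (y : L) := ⟨⟨_, ht⟩, rfl⟩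
  refine ⟨w, ?_, ?_⟩
  · rintro rfl
    simp [ht0] at hw
  · rw [RingOfIntegers.coe_gal_smul, ← hy, hw, map_zsmul, zsmul_eq_mul, zsmul_eq_mul]
    have : σ (y : L) ≠ 0 := by simp
    field_simp

end InvariantIdeals

/-! ### Hilbert's Theorem 94 and capitulation -/

section UnramifiedCyclic

variable {K L : Type} [Field K] [Field L] [Algebra K L]

theorem mem_range_one_sub_galUnitsEnd_iff {σ : Gal(L/K)} {u : Additive (𝓞 L)ˣ} :
    u ∈ (1 - galUnitsEnd σ).toAddMonoidHom.range ↔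
      ∃ v : (𝓞 L)ˣ, (u.toMul : 𝓞 L) * σ • (v : 𝓞 L) = v := by
  have key : ∀ v : (𝓞 L)ˣ, (1 - galUnitsEnd σ) (Additive.ofMul v) = u ↔
      (u.toMul : 𝓞 L) * σ • (v : 𝓞 L) = v := by
    intro v
    rw [LinearMap.sub_apply, sub_eq_iff_eq_add]
    constructor
    · intro h
      exact (congrArg (fun z : Additive (𝓞 L)ˣ => (z.toMul : 𝓞 L)) h).symm
    · intro h
      exact Additive.toMul.injective (Units.ext h.symm)
  constructor
  · rintro ⟨v, hv⟩
    exact ⟨v.toMul, (key _).mp hv⟩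
  · rintro ⟨v, hv⟩
    exact ⟨Additive.ofMul v, (key _).mpr hv⟩

variable [NumberField K] [NumberField L]

/-- The relative norm of the extended ideal is `J ^ [L : K]`, and it is generated by the norm of
`w`. -/
theorem mk0_pow_finrank_eq_one_of_map_eq_span {J : (Ideal (𝓞 K))⁰} {w : 𝓞 L}
    (hJ : (J : Ideal (𝓞 K)).map (algebraMap (𝓞 K) (𝓞 L)) = Ideal.span {w}) :
    ClassGroup.mk0 J ^ Module.finrank K L = 1 := by
  rw [← map_pow]
  have h : ((J ^ Module.finrank K L : (Ideal (𝓞 K))⁰) : Ideal (𝓞 K)) =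
      Ideal.span {Algebra.intNorm (𝓞 K) (𝓞 L) w} := by
    rw [← Ideal.relNorm_singleton, ← hJ, Ideal.relNorm_algebraMap, SubmonoidClass.coe_pow,
      IsFractionRing.finrank_eq (𝓞 K) K (𝓞 L) L]
  exact (ClassGroup.mk0_eq_one_iff _).mpr (⟨_, h⟩)

variable [IsGalois K L]

theorem norm_coe_eq_one_of_sum_galUnitsEnd_eq_zero {σ : Gal(L/K)}
    (hσ : ∀ τ, τ ∈ Subgroup.zpowers σ) {u : Additive (𝓞 L)ˣ}
    (hu : (∑ i ∈ Finset.range (Module.finrank K L), galUnitsEnd σ ^ i) u = 0) :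
    Algebra.norm K ((u.toMul : 𝓞 L) : L) = 1 := by
  apply FaithfulSMul.algebraMap_injective K L
  rw [algebraMap_norm_eq_prod_range hσ, map_one]
  have h := congrArg (algebraMap (𝓞 L) L) (coe_sum_galUnitsEnd σ (Module.finrank K L) u)
  rw [hu, map_prod] at h
  exact h.symm.trans (map_one _)

/-- A unit of norm one is `w / σ w` with the ideal `(w)` extended from an ideal of `K`. -/
theorem exists_ideal_map_eq_span_of_norm_eq_one
    (hunr : ∀ v : IsDedekindDomain.HeightOneSpectrum (𝓞 K),
      Algebra.IsUnramifiedIn (𝓞 L) v.asIdeal)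
    {σ : Gal(L/K)} (hσ : ∀ τ, τ ∈ Subgroup.zpowers σ) {u : (𝓞 L)ˣ}
    (hu : Algebra.norm K ((u : 𝓞 L) : L) = 1) :
    ∃ (w : 𝓞 L) (J : (Ideal (𝓞 K))⁰), w ≠ 0 ∧ u * σ • w = w ∧
      (J : Ideal (𝓞 K)).map (algebraMap (𝓞 K) (𝓞 L)) = Ideal.span {w} := by
  obtain ⟨w, hw0, hw⟩ := exists_integral_mul_gal_eq hσ hu
  have hw' : u * σ • w = w := NumberField.RingOfIntegers.ext hw
  have hs : σ • Ideal.span {w} = Ideal.span {w} := by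
    rw [Ideal.pointwise_smul_def, Ideal.map_span, Set.image_singleton]
    apply Ideal.span_singleton_eq_span_singleton.mpr
    exact ⟨u, by rw [mul_comm]; exact hw'⟩
  have hspan0 : Ideal.span {w} ≠ ⊥ := by simpa using hw0
  obtain ⟨J, hJ⟩ := exists_map_eq_of_gal_smul_eq hunr _ hspan0
    (smul_eq_of_generator_smul_eq hσ hs)
  have hJ0 : J ≠ ⊥ := by
    rintro rfl
    rw [Ideal.map_bot] at hJ
    exact hspan0 hJ.symm
  exact ⟨w, ⟨J, mem_nonZeroDivisors_of_ne_zero hJ0⟩, hw0, hw', hJ⟩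

/-- This is the injectivity of the map from `Ĥ⁻¹` of the units to the class group of `K` sending `u
= w / σ w` to the class of `J`. A relation `x J = y J'` gives `x w v = y w'` for a unit `v`;
dividing by its image under `σ` yields `u' = u * (v / σ v)`. -/
theorem exists_unit_of_mk0_eq {σ : Gal(L/K)} {u u' : (𝓞 L)ˣ} {w w' : 𝓞 L}
    {J J' : (Ideal (𝓞 K))⁰} (hw0 : w ≠ 0) (hw : u * σ • w = w)
    (hw' : u' * σ • w' = w')
    (hJ : (J : Ideal (𝓞 K)).map (algebraMap (𝓞 K) (𝓞 L)) = Ideal.span {w})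
    (hJ' : (J' : Ideal (𝓞 K)).map (algebraMap (𝓞 K) (𝓞 L)) = Ideal.span {w'})
    (h : ClassGroup.mk0 J = ClassGroup.mk0 J') :
    ∃ v : (𝓞 L)ˣ, (u' : 𝓞 L) * σ • (v : 𝓞 L) = u * v := by
  obtain ⟨x, y, hx, hy, hxy⟩ := ClassGroup.mk0_eq_mk0_iff.mp h
  set X := algebraMap (𝓞 K) (𝓞 L) x with hX
  set Y := algebraMap (𝓞 K) (𝓞 L) y with hY
  have hinj := FaithfulSMul.algebraMap_injective (𝓞 K) (𝓞 L)
  have hX0 : X ≠ 0 := (map_ne_zero_iff _ hinj).mpr hx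
  have hY0 : Y ≠ 0 := (map_ne_zero_iff _ hinj).mpr hy
  have h1 := congrArg (Ideal.map (algebraMap (𝓞 K) (𝓞 L))) hxy
  rw [Ideal.map_mul, Ideal.map_mul, hJ, hJ', Ideal.map_span, Ideal.map_span, Set.image_singleton,
    Set.image_singleton, Ideal.span_singleton_mul_span_singleton,
    Ideal.span_singleton_mul_span_singleton, Ideal.span_singleton_eq_span_singleton] at h1
  obtain ⟨v, hv⟩ := h1
  refine ⟨v, ?_⟩
  have hv2 : X * σ • w * σ • (v : 𝓞 L) = Y * σ • w' := by
    have := congrArg (σ • ·) hv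
    simp only [smul_mul'] at this
    rwa [smul_algebraMap, smul_algebraMap] at this
  have hsw : σ • w ≠ 0 := by
    intro h0; rw [h0, mul_zero] at hw; exact hw0 hw.symm
  apply mul_left_cancel₀ (mul_ne_zero hX0 hsw)
  calc X * σ • w * (u' * σ • (v : 𝓞 L)) = u' * (X * σ • w * σ • (v : 𝓞 L)) := by ring
    _ = Y * (u' * σ • w') := by rw [hv2]; ring
    _ = X * (u * σ • w) * v := by rw [hw', hw]; exact hv.symm
    _ = X * σ • w * (u * v) := by ring

theorem exists_generator_of_finrank_prime {p : ℕ} [hp : Fact p.Prime]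
    (hKL : Module.finrank K L = p) : ∃ σ : Gal(L/K), ∀ τ, τ ∈ Subgroup.zpowers σ := by
  have hc : Nat.card Gal(L/K) = p := by rw [IsGalois.card_aut_eq_finrank, hKL]
  exact (isCyclic_of_prime_card hc).exists_generator

/-- **Hilbert's Theorem 94**: in an unramified extension of prime degree some nonprincipal ideal
becomes principal. -/
theorem exists_nonprincipal_map_eq_span [IsUnramifiedAtInfinitePlaces K L]
    (hunr : ∀ v : IsDedekindDomain.HeightOneSpectrum (𝓞 K),
      Algebra.IsUnramifiedIn (𝓞 L) v.asIdeal) {p : ℕ} [hp : Fact p.Prime]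
    (hKL : Module.finrank K L = p) :
    ∃ (J : (Ideal (𝓞 K))⁰) (w : 𝓞 L), ClassGroup.mk0 J ≠ 1 ∧
      (J : Ideal (𝓞 K)).map (algebraMap (𝓞 K) (𝓞 L)) = Ideal.span {w} := by
  obtain ⟨σ, hσ⟩ := exists_generator_of_finrank_prime hKL
  set g := ∑ i ∈ Finset.range p, galUnitsEnd σ ^ i with hg
  obtain ⟨h0, h1⟩ := units_herbrand hKL hσ g hg
  -- The order of `Ĥ⁻¹` is a multiple of `p`, so it is not 1.
  obtain ⟨u, hug, hu⟩ : ∃ u, g u = 0 ∧ u ∉ (1 - galUnitsEnd σ).toAddMonoidHom.range := by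
    by_contra! hcon
    have : (1 - galUnitsEnd σ).toAddMonoidHom.range.relIndex g.toAddMonoidHom.ker = 1 :=
      AddSubgroup.relIndex_eq_one.mpr fun u hu => hcon u hu
    rw [this] at h1
    exact hp.out.one_lt.ne' (Nat.eq_one_of_mul_eq_one_right h1.symm)
  have hn : Algebra.norm K ((u.toMul : 𝓞 L) : L) = 1 :=
    norm_coe_eq_one_of_sum_galUnitsEnd_eq_zero hσ (by rw [hKL]; exact hug)
  obtain ⟨w, J, hw0, hw, hJ⟩ := exists_ideal_map_eq_span_of_norm_eq_one hunr hσ hn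
  refine ⟨J, w, fun hJ1 => hu ?_, hJ⟩
  -- If `J` were principal, comparison with the trivial data would give `u = v / σ v`.
  obtain ⟨v, hv⟩ := exists_unit_of_mk0_eq (σ := σ) (u := 1) (u' := u.toMul) (w := 1) (w' := w)
    (J := 1) (J' := J) one_ne_zero (by simp) hw (by simp [Ideal.map_top]) hJ
    (by rw [hJ1, map_one])
  rw [mem_range_one_sub_galUnitsEnd_iff]
  exact ⟨v, by rw [hv]; simp⟩

theorem dvd_classNumber_of_finrank_prime [IsUnramifiedAtInfinitePlaces K L]
    (hunr : ∀ v : IsDedekindDomain.HeightOneSpectrum (𝓞 K),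
      Algebra.IsUnramifiedIn (𝓞 L) v.asIdeal) {p : ℕ} [hp : Fact p.Prime]
    (hKL : Module.finrank K L = p) : p ∣ NumberField.classNumber K := by
  obtain ⟨J, w, hJ1, hJ⟩ := exists_nonprincipal_map_eq_span hunr hKL
  have hord : orderOf (ClassGroup.mk0 J) = p :=
    orderOf_eq_prime (by rw [← hKL]; exact mk0_pow_finrank_eq_one_of_map_eq_span hJ) hJ1
  rw [← hord, NumberField.classNumber]
  exact orderOf_dvd_card

/-- If the class number equals the prime degree of an unramified extension `L / K`, then every
unit of `K` is the norm of a unit of `L`. -/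
theorem exists_unit_prod_gal_eq [IsUnramifiedAtInfinitePlaces K L]
    (hunr : ∀ v : IsDedekindDomain.HeightOneSpectrum (𝓞 K),
      Algebra.IsUnramifiedIn (𝓞 L) v.asIdeal) {p : ℕ} [hp : Fact p.Prime]
    (hKL : Module.finrank K L = p) (hK : NumberField.classNumber K = p)
    {σ : Gal(L/K)} (hσ : ∀ τ, τ ∈ Subgroup.zpowers σ) (ε : (𝓞 K)ˣ) :
    ∃ v : (𝓞 L)ˣ, Algebra.norm K ((v : 𝓞 L) : L) = ((ε : 𝓞 K) : K) := by
  set g := ∑ i ∈ Finset.range p, galUnitsEnd σ ^ i with hg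
  obtain ⟨h0, h1⟩ := units_herbrand hKL hσ g hg
  have hdata : ∀ u : g.toAddMonoidHom.ker, ∃ (J : (Ideal (𝓞 K))⁰) (w : 𝓞 L), w ≠ 0 ∧
      ((u : Additive (𝓞 L)ˣ).toMul : 𝓞 L) * σ • w = w ∧
      (J : Ideal (𝓞 K)).map (algebraMap (𝓞 K) (𝓞 L)) = Ideal.span {w} := by
    intro u
    obtain ⟨w, J, h⟩ := exists_ideal_map_eq_span_of_norm_eq_one hunr hσ
      (norm_coe_eq_one_of_sum_galUnitsEnd_eq_zero hσ (by rw [hKL]; exact u.2))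
    exact ⟨J, w, h⟩
  choose J w hw0 hw hJ using hdata
  -- `Ĥ⁻¹` injects into a class group of order `p`. As its order is `p` times that of `Ĥ⁰`, the
  -- latter is trivial, which is the claim about norms.
  have hle : (1 - galUnitsEnd σ).toAddMonoidHom.range.relIndex g.toAddMonoidHom.ker ≤ p := by
    rw [← hK, NumberField.classNumber, ← Nat.card_eq_fintype_card]
    apply Nat.card_le_card_of_injective (fun q => ClassGroup.mk0 (J q.out))
    intro q q' hqq
    obtain ⟨v, hv⟩ := exists_unit_of_mk0_eq (hw0 _) (hw _) (hw _) (hJ _) (hJ _) hqq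
    rw [← QuotientAddGroup.out_eq' q, ← QuotientAddGroup.out_eq' q', QuotientAddGroup.eq,
      AddSubgroup.mem_addSubgroupOf, mem_range_one_sub_galUnitsEnd_iff]
    refine ⟨v, ?_⟩
    rw [AddSubgroup.coe_add, AddSubgroup.coe_neg, toMul_add, toMul_neg, Units.val_mul, mul_assoc,
      Units.inv_mul_eq_iff_eq_mul]
    exact hv
  rw [h1] at hle
  have h01 : g.toAddMonoidHom.range.relIndex (1 - galUnitsEnd σ).toAddMonoidHom.ker = 1 := by
    have := hp.out.pos
    nlinarith [Nat.pos_of_ne_zero h0]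
  rw [AddSubgroup.relIndex_eq_one] at h01
  let ε' : (𝓞 L)ˣ := Units.map (algebraMap (𝓞 K) (𝓞 L) : 𝓞 K →* 𝓞 L) ε
  have hε : Additive.ofMul ε' ∈ (1 - galUnitsEnd σ).toAddMonoidHom.ker :=
    mem_ker_one_sub_galUnitsEnd.mpr (smul_algebraMap σ (ε : 𝓞 K))
  obtain ⟨v, hv⟩ := h01 hε
  refine ⟨v.toMul, ?_⟩
  apply FaithfulSMul.algebraMap_injective K L
  have h := congrArg (algebraMap (𝓞 L) L) (coe_sum_galUnitsEnd σ p v)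
  rw [map_prod] at h
  rw [algebraMap_norm_eq_prod_range hσ, hKL]
  refine h.symm.trans ?_
  change algebraMap (𝓞 L) L ((g v).toMul : 𝓞 L) = _
  have hv' : g v = Additive.ofMul ε' := hv
  rw [hv']
  rfl

/-- By Theorem 94 the kernel of extension of classes is nontrivial, so in a group of prime order it
is everything. -/
theorem mk0_map_eq_one_of_classNumber_eq [IsUnramifiedAtInfinitePlaces K L]
    (hunr : ∀ v : IsDedekindDomain.HeightOneSpectrum (𝓞 K),
      Algebra.IsUnramifiedIn (𝓞 L) v.asIdeal) {p : ℕ} [hp : Fact p.Prime]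
    (hKL : Module.finrank K L = p) (hK : NumberField.classNumber K = p) (c : ClassGroup (𝓞 K)) :
    ClassGroup.extendedHom (𝓞 K) (𝓞 L) c = 1 := by
  obtain ⟨J, w, hJ1, hJ⟩ := exists_nonprincipal_map_eq_span hunr hKL
  have hc : Nat.card (ClassGroup (𝓞 K)) = p := by
    rw [Nat.card_eq_fintype_card]; exact hK
  have : Fact (Nat.card (ClassGroup (𝓞 K))).Prime := by rw [hc]; exact hp
  have hker : ClassGroup.mk0 J ∈ (ClassGroup.extendedHom (𝓞 K) (𝓞 L)).ker := by
    rw [MonoidHom.mem_ker, ClassGroup.extendedHom_mk0]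
    exact (ClassGroup.mk0_eq_one_iff _).mpr ⟨_, hJ⟩
  rcases (ClassGroup.extendedHom (𝓞 K) (𝓞 L)).ker.eq_bot_or_eq_top_of_prime_card with h | h
  · rw [h, Subgroup.mem_bot] at hker
    exact absurd hker hJ1
  · have : c ∈ (ClassGroup.extendedHom (𝓞 K) (𝓞 L)).ker := by rw [h]; trivial
    exact this

end UnramifiedCyclic

/-! ### Invariant ideal classes of the extension -/

section AmbiguousClasses

variable {K L : Type} [Field K] [Field L] [Algebra K L] [NumberField K] [NumberField L]
  [IsGalois K L]

/-- If `h_K` equals the prime degree of an unramified extension `L / K`, then only the trivial ideal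
class of `L` is invariant under the Galois group. -/
theorem mk0_eq_one_of_gal_invariant [IsUnramifiedAtInfinitePlaces K L]
    (hunr : ∀ v : IsDedekindDomain.HeightOneSpectrum (𝓞 K),
      Algebra.IsUnramifiedIn (𝓞 L) v.asIdeal) {p : ℕ} [hp : Fact p.Prime]
    (hKL : Module.finrank K L = p) (hK : NumberField.classNumber K = p)
    {σ : Gal(L/K)} (hσ : ∀ τ, τ ∈ Subgroup.zpowers σ) {I I' : (Ideal (𝓞 L))⁰}
    (hII' : (I' : Ideal (𝓞 L)) = σ • (I : Ideal (𝓞 L)))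
    (hI : ClassGroup.mk0 I' = ClassGroup.mk0 I) : ClassGroup.mk0 I = 1 := by
  obtain ⟨x, y, hx, hy, hxy⟩ := ClassGroup.mk0_eq_mk0_iff.mp hI
  rw [hII'] at hxy
  have hI0 : (I : Ideal (𝓞 L)) ≠ 0 := nonZeroDivisors.coe_ne_zero I
  -- the norms of `x` and `y` are associated
  have hn := congrArg (Ideal.relNorm (𝓞 K)) hxy
  rw [map_mul, map_mul, Ideal.relNorm_smul] at hn
  have hrel0 : Ideal.relNorm (𝓞 K) (I : Ideal (𝓞 L)) ≠ 0 :=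
    fun h => hI0 (Ideal.relNorm_eq_bot_iff.mp h)
  have hn' := mul_right_cancel₀ hrel0 hn
  rw [Ideal.relNorm_singleton, Ideal.relNorm_singleton,
    Ideal.span_singleton_eq_span_singleton] at hn'
  obtain ⟨ε, hε⟩ := hn'
  -- A unit `v` of norm `ε⁻¹` corrects `y`, so that `y v / x` has norm one and Hilbert 90 applies.
  obtain ⟨v, hv⟩ := exists_unit_prod_gal_eq hunr hKL hK hσ ε⁻¹
  have hxn : Algebra.norm K (x : L) ≠ 0 := by
    rw [Algebra.norm_ne_zero_iff]; simpa using hx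
  have hyv : Algebra.norm K ((y * v : L) / x) = 1 := by
    rw [div_eq_mul_inv, map_mul, Algebra.norm_inv, ← div_eq_mul_inv, map_mul, hv]
    have h := congrArg (algebraMap (𝓞 K) K) hε
    rw [map_mul, Algebra.algebraMap_intNorm (L := L), Algebra.algebraMap_intNorm (L := L)] at h
    have hεε : algebraMap (𝓞 K) K (ε : 𝓞 K) * algebraMap (𝓞 K) K ((ε⁻¹ : (𝓞 K)ˣ) : 𝓞 K) = 1 := by
      rw [← map_mul, Units.mul_inv, map_one]
    rw [div_eq_one_iff_eq hxn]
    calc _ = Algebra.norm K (algebraMap (𝓞 L) L y) *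
          algebraMap (𝓞 K) K ((ε⁻¹ : (𝓞 K)ˣ) : 𝓞 K) := rfl
      _ = _ := by rw [← h, mul_assoc, hεε, mul_one]
  obtain ⟨w, hw0, hw⟩ := exists_integral_mul_gal_eq hσ hyv
  have hxL : (x : L) ≠ 0 := by simpa using hx
  have hw' : y * v * σ • w = x * w := by
    apply NumberField.RingOfIntegers.ext
    rw [div_mul_eq_mul_div, div_eq_iff hxL] at hw
    rw [mul_comm x w]
    exact hw
  -- the ideal `w I` is invariant
  have hinv : σ • (Ideal.span {w} * (I : Ideal (𝓞 L))) = Ideal.span {w} * (I : Ideal (𝓞 L)) := by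
    have hx0 : Ideal.span {x} ≠ (0 : Ideal (𝓞 L)) := by simpa using hx
    apply mul_left_cancel₀ hx0
    have hsw : σ • Ideal.span {w} = Ideal.span {σ • w} := by
      rw [Ideal.pointwise_smul_def, Ideal.map_span, Set.image_singleton]; rfl
    have hv1 : Ideal.span {(v : 𝓞 L)} = 1 := by
      rw [Ideal.one_eq_top, Ideal.span_singleton_eq_top]; exact v.isUnit
    calc Ideal.span {x} * σ • (Ideal.span {w} * (I : Ideal (𝓞 L)))
        = Ideal.span {σ • w} * (Ideal.span {x} * σ • (I : Ideal (𝓞 L))) := by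
          rw [smul_mul', hsw, mul_left_comm]
      _ = Ideal.span {y} * Ideal.span {(v : 𝓞 L)} * Ideal.span {σ • w} * I := by
          rw [hxy, hv1, mul_one]; ring
      _ = Ideal.span {x} * (Ideal.span {w} * I) := by
          rw [Ideal.span_singleton_mul_span_singleton, Ideal.span_singleton_mul_span_singleton, hw',
            ← Ideal.span_singleton_mul_span_singleton, mul_assoc]
  have hwI0 : Ideal.span {w} * (I : Ideal (𝓞 L)) ≠ ⊥ :=
    mul_ne_zero (by simpa using hw0) hI0
  obtain ⟨J, hJ⟩ := exists_map_eq_of_gal_smul_eq hunr _ hwI0 (smul_eq_of_generator_smul_eq hσ hinv)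
  have hJ0 : J ≠ 0 := by
    rintro rfl
    rw [Ideal.zero_eq_bot, Ideal.map_bot] at hJ
    exact hwI0 hJ.symm
  -- The invariant ideal `w I` comes from an ideal `J` of `K`, and every ideal of `K` becomes
  -- principal in `L`.
  have hcap := mk0_map_eq_one_of_classNumber_eq hunr hKL hK
    (ClassGroup.mk0 ⟨J, mem_nonZeroDivisors_of_ne_zero hJ0⟩)
  rw [ClassGroup.extendedHom_mk0] at hcap
  rw [← hcap, ClassGroup.mk0_eq_mk0_iff]
  exact ⟨w, 1, hw0, one_ne_zero, by simpa using hJ.symm⟩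

/-- A group of order `p` acts on the classes of `L` with a single fixed point, so the class number
is 1 modulo `p`. -/
theorem not_dvd_classNumber_of_classNumber_eq [IsUnramifiedAtInfinitePlaces K L]
    (hunr : ∀ v : IsDedekindDomain.HeightOneSpectrum (𝓞 K),
      Algebra.IsUnramifiedIn (𝓞 L) v.asIdeal) {p : ℕ} [hp : Fact p.Prime]
    (hKL : Module.finrank K L = p) (hK : NumberField.classNumber K = p) :
    ¬ p ∣ NumberField.classNumber L := by
  classical
  obtain ⟨σ, hσ⟩ := exists_generator_of_finrank_prime hKL
  have hs0 : ∀ (τ : Gal(L/K)) (I : (Ideal (𝓞 L))⁰), τ • (I : Ideal (𝓞 L)) ∈ (Ideal (𝓞 L))⁰ := by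
    intro τ I
    apply mem_nonZeroDivisors_of_ne_zero
    rw [smul_ne_zero_iff_ne]
    exact nonZeroDivisors.coe_ne_zero I
  have hwd : ∀ I J : (Ideal (𝓞 L))⁰, ClassGroup.mk0 I = ClassGroup.mk0 J →
      ClassGroup.mk0 ⟨_, hs0 σ I⟩ = ClassGroup.mk0 ⟨_, hs0 σ J⟩ := by
    intro I J h
    obtain ⟨x, y, hx, hy, hxy⟩ := ClassGroup.mk0_eq_mk0_iff.mp h
    refine ClassGroup.mk0_eq_mk0_iff.mpr ⟨σ • x, σ • y, ?_, ?_, ?_⟩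
    · rwa [smul_ne_zero_iff_ne]
    · rwa [smul_ne_zero_iff_ne]
    · have h := congrArg (σ • ·) hxy
      simp only [smul_mul', Ideal.pointwise_smul_def, Ideal.map_span, Set.image_singleton] at h
      exact h
  choose rep hrep using ClassGroup.mk0_surjective (R := 𝓞 L)
  -- The action of `σ` on classes, through chosen representatives; `hwd` makes it independent of the
  -- choice.
  let F : Function.End (ClassGroup (𝓞 L)) := fun c => ClassGroup.mk0 ⟨_, hs0 σ (rep c)⟩
  have hF : ∀ I, F (ClassGroup.mk0 I) = ClassGroup.mk0 ⟨_, hs0 σ I⟩ :=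
    fun I => hwd _ _ (hrep _)
  have hFn : ∀ (n : ℕ) I, (F ^ n) (ClassGroup.mk0 I) = ClassGroup.mk0 ⟨_, hs0 (σ ^ n) I⟩ := by
    intro n I
    induction n with
    | zero =>
      simp only [pow_zero, one_smul]
      rfl
    | succ n ih =>
      rw [pow_succ']
      change F ((F ^ n) _) = _
      rw [ih, hF]
      simp only [pow_succ', mul_smul]
  have hord : orderOf σ = p := by
    rw [← hKL, ← IsGalois.card_aut_eq_finrank, orderOf_eq_card_of_forall_mem_zpowers hσ]
  have hFp : F ^ p ^ 1 = 1 := by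
    funext c
    obtain ⟨I, rfl⟩ := ClassGroup.mk0_surjective c
    rw [pow_one, hFn]
    have : σ ^ p = 1 := by rw [← hord, pow_orderOf_eq_one]
    simp only [this, one_smul]
    rfl
  have hmod := Equiv.Perm.card_fixedPoints_modEq hFp
  have hfix : Fintype.card F.fixedPoints = 1 := by
    rw [Fintype.card_eq_one_iff]
    refine ⟨⟨1, ?_⟩, ?_⟩
    · change F 1 = 1
      rw [← map_one (ClassGroup.mk0 (R := 𝓞 L)), hF]
      congr 1
      apply Subtype.ext
      exact smul_one σ
    · rintro ⟨c, hc⟩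
      apply Subtype.ext
      obtain ⟨I, rfl⟩ := ClassGroup.mk0_surjective c
      exact mk0_eq_one_of_gal_invariant hunr hKL hK hσ (I' := ⟨_, hs0 σ I⟩) rfl
        ((hF I).symm.trans hc)
  rw [hfix] at hmod
  intro hdvd
  have h0 : Fintype.card (ClassGroup (𝓞 L)) ≡ 0 [MOD p] := (Nat.modEq_zero_iff_dvd).mpr hdvd
  have h1 : p ∣ 1 := (Nat.modEq_zero_iff_dvd).mp (hmod.symm.trans h0)
  exact hp.out.one_lt.ne' (Nat.dvd_one.mp h1)

end AmbiguousClasses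

/-! ### Unramified towers and inertia groups -/

section Unramified

/-- An element of order `p` prevents the `p`-th power map from being onto. A maximal subgroup
containing all `p`-th powers has a simple quotient of exponent `p`. -/
theorem exists_subgroup_index_eq_prime {G : Type*} [CommGroup G] [Finite G] {p : ℕ}
    [hp : Fact p.Prime] (h : p ∣ Nat.card G) : ∃ H : Subgroup G, H.index = p := by
  obtain ⟨g, hg⟩ := exists_prime_orderOf_dvd_card' p h
  have hne : (powMonoidHom p : G →* G).range ≠ ⊤ := by
    intro htop
    have hsurj := MonoidHom.range_eq_top.mp htop
    have hinj := Finite.injective_iff_surjective.mpr hsurj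
    have : g = 1 := hinj (by
      rw [powMonoidHom_apply, powMonoidHom_apply, one_pow, ← hg, pow_orderOf_eq_one])
    rw [this, orderOf_one] at hg
    exact hp.out.one_lt.ne hg
  obtain ⟨H, hH, hle⟩ := (eq_top_or_exists_le_coatom _).resolve_left hne
  have hsimple : IsSimpleGroup (G ⧸ H) := by
    have hnt : Nontrivial (G ⧸ H) := by
      obtain ⟨x, hx⟩ : ∃ x, x ∉ H := by
        by_contra! hall
        exact hH.1 ((Subgroup.eq_top_iff' H).mpr hall)
      exact ⟨(x : G ⧸ H), 1, fun h => hx ((QuotientGroup.eq_one_iff x).mp h)⟩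
    refine ⟨fun S _ => ?_⟩
    have hHS : H ≤ S.comap (QuotientGroup.mk' H) := by
      intro x hx
      rw [Subgroup.mem_comap, QuotientGroup.mk'_apply, (QuotientGroup.eq_one_iff x).mpr hx]
      exact S.one_mem
    have hmap := Subgroup.map_comap_eq_self_of_surjective (QuotientGroup.mk'_surjective H) S
    rcases hH.le_iff.mp hHS with h | h
    · right
      rw [← hmap, h, ← MonoidHom.range_eq_map, QuotientGroup.range_mk']
    · left
      rw [← hmap, h, QuotientGroup.map_mk'_self]
  have hq : (Nat.card (G ⧸ H)).Prime := IsSimpleGroup.prime_card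
  have hdvd : ∀ x : G ⧸ H, x ^ p = 1 := by
    intro x
    obtain ⟨x, rfl⟩ := QuotientGroup.mk_surjective x
    rw [← QuotientGroup.mk_pow, QuotientGroup.eq_one_iff]
    exact hle ⟨x, rfl⟩
  refine ⟨H, ?_⟩
  have := Fact.mk hq
  obtain ⟨x, hx⟩ := exists_prime_orderOf_dvd_card' (G := G ⧸ H) _ dvd_rfl
  have h1 : Nat.card (G ⧸ H) ∣ p := hx ▸ orderOf_dvd_of_pow_eq_one (hdvd x)
  exact (Nat.prime_dvd_prime_iff_eq hq hp.out).mp h1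

variable {K L N : Type*} [Field K] [Field L] [Field N] [Algebra K L] [Algebra L N] [Algebra K N]
  [IsScalarTower K L N]

theorem isUnramifiedIn_top_of_tower
    (hunr : ∀ v : IsDedekindDomain.HeightOneSpectrum (𝓞 K),
      Algebra.IsUnramifiedIn (𝓞 N) v.asIdeal) (v : IsDedekindDomain.HeightOneSpectrum (𝓞 L)) :
    Algebra.IsUnramifiedIn (𝓞 N) v.asIdeal := by
  intro P hP hPv
  have hv0 : v.asIdeal.under (𝓞 K) ≠ ⊥ := Ideal.under_ne_bot (𝓞 K) v.ne_bot
  have h3 : P.LiesOver (v.asIdeal.under (𝓞 K)) := Ideal.LiesOver.trans P v.asIdeal _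
  have := hunr ⟨v.asIdeal.under (𝓞 K), inferInstance, hv0⟩ P hP h3
  exact Algebra.IsUnramifiedAt.of_restrictScalars (𝓞 K) P

variable [NumberField K] [NumberField L] [NumberField N]

theorem isUnramifiedIn_bot_of_tower
    (hunr : ∀ v : IsDedekindDomain.HeightOneSpectrum (𝓞 K),
      Algebra.IsUnramifiedIn (𝓞 N) v.asIdeal) (v : IsDedekindDomain.HeightOneSpectrum (𝓞 K)) :
    Algebra.IsUnramifiedIn (𝓞 L) v.asIdeal := by
  intro P hP hPv
  obtain ⟨⟨Q, hQ, hQP⟩⟩ := Ideal.nonempty_primesOver (S := 𝓞 N) P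
  have h3 : Q.LiesOver v.asIdeal := Ideal.LiesOver.trans Q P v.asIdeal
  have := hunr v Q hQ h3
  exact Algebra.IsUnramifiedAt.of_liesOver (𝓞 K) P Q

/-- The prime divisors of the degree of an abelian unramified extension of `K` divide the class
number of `K`. -/
theorem prime_dvd_classNumber {K N : Type} [Field K] [Field N] [NumberField K] [NumberField N]
    [Algebra K N] [IsAbelianGalois K N] [IsUnramifiedAtInfinitePlaces K N]
    (hunr : ∀ v : IsDedekindDomain.HeightOneSpectrum (𝓞 K),
      Algebra.IsUnramifiedIn (𝓞 N) v.asIdeal) {p : ℕ} (hp : p.Prime)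
    (hdvd : p ∣ Module.finrank K N) : p ∣ NumberField.classNumber K := by
  have := Fact.mk hp
  let _ : CommGroup Gal(N/K) := { mul_comm := fun a b => Std.Commutative.comm a b }
  -- The fixed field of a subgroup of index `p` is an unramified extension of degree `p`, to which
  -- Theorem 94 applies.
  obtain ⟨H, hH⟩ := exists_subgroup_index_eq_prime (G := Gal(N/K)) (p := p)
    (by rwa [IsGalois.card_aut_eq_finrank])
  let E := IntermediateField.fixedField H
  have hE : Module.finrank K E = p := by
    rw [IntermediateField.finrank_eq_fixingSubgroup_index, IntermediateField.fixingSubgroup_fixedField,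
      hH]
  have : NumberField E := NumberField.of_module_finite K E
  have : IsUnramifiedAtInfinitePlaces K E := IsUnramifiedAtInfinitePlaces.bot K E N
  exact dvd_classNumber_of_finrank_prime (L := E) (isUnramifiedIn_bot_of_tower (N := N) hunr) hE

/-- Inertia groups at unramified primes are trivial. -/
theorem eq_one_of_isUnramifiedAt {k E : Type*} [Field k] [Field E] [Algebra k E] [NumberField E]
    [FiniteDimensional k E]
    (R : Type*) [CommRing R] [IsDomain R] [CharZero R] [Module.Finite ℤ R] [Algebra R (𝓞 E)]
    [Module.Finite R (𝓞 E)] [Module.Flat R (𝓞 E)] [IsGaloisGroup Gal(E/k) R (𝓞 E)]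
    (P : Ideal (𝓞 E)) [P.IsPrime] [Algebra.IsUnramifiedAt R P] (σ : Gal(E/k))
    (hσ : ∀ x : 𝓞 E, σ • x - x ∈ P) : σ = 1 := by
  have h1 : P.ramificationIdx R = 1 := Ideal.ramificationIdx_eq_one_iff.mpr inferInstance
  have h2 := Ideal.card_inertia_eq_ramificationIdxIn (G := Gal(E/k)) (P.under R) P
  rw [Ideal.ramificationIdxIn_eq_ramificationIdx (P.under R) P Gal(E/k), h1] at h2
  have h3 : P.inertia Gal(E/k) = ⊥ := Subgroup.card_eq_one.mp h2
  have h4 : σ ∈ P.inertia Gal(E/k) := hσ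
  rwa [h3, Subgroup.mem_bot] at h4

/-- An automorphism in the inertia group of a prime `P` of `N` fixes every normal subfield `E` in
which `P` is unramified. -/
theorem gal_apply_algebraMap_eq_of_isUnramifiedAt {k E N : Type*} [Field k] [Field E] [Field N]
    [Algebra k E] [Algebra E N] [Algebra k N] [IsScalarTower k E N] [NumberField E] [NumberField N]
    [FiniteDimensional k E] [IsGalois k E]
    (R : Type*) [CommRing R] [IsDomain R] [CharZero R] [Module.Finite ℤ R] [Algebra R (𝓞 E)]
    [Module.Finite R (𝓞 E)] [Module.Flat R (𝓞 E)] [IsGaloisGroup Gal(E/k) R (𝓞 E)]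
    (P : Ideal (𝓞 N)) [P.IsPrime] [Algebra.IsUnramifiedAt R (P.under (𝓞 E))] (σ : N →ₐ[k] N)
    (hσ : ∀ x y : 𝓞 N, σ x = y → y - x ∈ P) (e : E) :
    σ (algebraMap E N e) = algebraMap E N e := by
  let σ' := AlgHom.restrictNormal' σ E
  -- The restriction of `σ` to `E` lies in the inertia group of the prime below `P`, which is
  -- trivial.
  have hσ' : σ' = 1 := by
    apply eq_one_of_isUnramifiedAt R (P.under (𝓞 E))
    intro x
    rw [Ideal.mem_comap, map_sub]
    apply hσ
    exact (AlgHom.restrictNormal_commutes σ E (x : E)).symm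
  have h := AlgHom.restrictNormal_commutes σ E e
  have h2 : σ.restrictNormal E e = σ' e := rfl
  rw [← h, h2, hσ']
  rfl

/-- A Galois extension whose inertia groups are trivial is unramified. -/
theorem isUnramifiedIn_of_forall_inertia {K N : Type*} [Field K] [Field N] [NumberField K]
    [NumberField N] [Algebra K N] [IsGalois K N]
    (h : ∀ (P : Ideal (𝓞 N)) (σ : Gal(N/K)), P.IsPrime → P ≠ ⊥ → (∀ x : 𝓞 N, σ • x - x ∈ P) → σ = 1)
    (v : IsDedekindDomain.HeightOneSpectrum (𝓞 K)) :
    Algebra.IsUnramifiedIn (𝓞 N) v.asIdeal := by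
  intro P hP hPv
  have hP0 : P ≠ ⊥ := Ideal.ne_bot_of_liesOver_of_ne_bot v.ne_bot P
  have h3 : P.inertia Gal(N/K) = ⊥ := by
    rw [eq_bot_iff]
    intro σ hσ
    exact h P σ hP hP0 hσ
  have h2 := Ideal.card_inertia_eq_ramificationIdxIn (G := Gal(N/K)) (P.under (𝓞 K)) P
  rw [Ideal.ramificationIdxIn_eq_ramificationIdx (P.under (𝓞 K)) P Gal(N/K), h3,
    Subgroup.card_bot] at h2
  exact Ideal.ramificationIdx_eq_one_iff.mp h2.symm

end Unramified

/-! ### Composita of unramified abelian extensions -/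

section Compositum

variable {K Ω : Type*} [Field K] [Field Ω] [Algebra K Ω]

theorem IntermediateField.algEquiv_sup_eq_one {L₁ L₂ : IntermediateField K Ω}
    [FiniteDimensional K L₁] [FiniteDimensional K L₂]
    (σ : Gal(↥(L₁ ⊔ L₂)/K))
    (h₁ : ∀ x : L₁, σ (inclusion le_sup_left x) = inclusion le_sup_left x)
    (h₂ : ∀ x : L₂, σ (inclusion le_sup_right x) = inclusion le_sup_right x) : σ = 1 := by
  let S : IntermediateField K ↥(L₁ ⊔ L₂) := fixedField (Subgroup.zpowers σ)
  have hS : ∀ x, x ∈ S ↔ σ x = x := by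
    intro x
    constructor
    · intro hx
      exact hx ⟨σ, Subgroup.mem_zpowers σ⟩
    · rintro hx ⟨τ, hτ⟩
      have : Subgroup.zpowers σ ≤ MulAction.stabilizer Gal(↥(L₁ ⊔ L₂)/K) x := by
        rw [Subgroup.zpowers_le]; exact hx
      exact this hτ
  have hle : L₁ ⊔ L₂ ≤ IntermediateField.lift S := by
    refine sup_le (fun x hx => ?_) (fun x hx => ?_)
    · exact ⟨inclusion le_sup_left ⟨x, hx⟩, (hS _).mpr (h₁ _), rfl⟩
    · exact ⟨inclusion le_sup_right ⟨x, hx⟩, (hS _).mpr (h₂ _), rfl⟩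
  ext x
  obtain ⟨y, hy, hxy⟩ := hle x.2
  have : y = x := Subtype.ext hxy
  rw [← this, (hS y).mp hy]
  rfl

/-- A commutator restricts to the identity on each factor, hence is trivial on the compositum. -/
theorem IntermediateField.isAbelianGalois_sup (L₁ L₂ : IntermediateField K Ω)
    [FiniteDimensional K L₁] [FiniteDimensional K L₂] [IsAbelianGalois K L₁]
    [IsAbelianGalois K L₂] : IsAbelianGalois K ↥(L₁ ⊔ L₂) := by
  refine { is_comm.comm := fun σ τ => ?_ }
  have key : ∀ (L : IntermediateField K Ω) (hL : L ≤ L₁ ⊔ L₂) [IsAbelianGalois K L] (x : L),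
      (σ * τ) (inclusion hL x) = (τ * σ) (inclusion hL x) := by
    intro L hL _ x
    let _ : Algebra L ↥(L₁ ⊔ L₂) := (inclusion hL).toAlgebra
    have : IsScalarTower K L ↥(L₁ ⊔ L₂) := IsScalarTower.of_algebraMap_eq' (by ext; rfl)
    have hc : (σ * τ).restrictNormal L = (τ * σ).restrictNormal L := by
      have := IsMulCommutative.is_comm.comm (σ.restrictNormal L) (τ.restrictNormal L)
      have hm := map_mul (AlgEquiv.restrictNormalHom (F := K) (K₁ := ↥(L₁ ⊔ L₂)) L)
      exact (hm σ τ).trans (this.trans (hm τ σ).symm)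
    have e1 := AlgEquiv.restrictNormal_commutes (σ * τ) L x
    have e2 := AlgEquiv.restrictNormal_commutes (τ * σ) L x
    rw [hc] at e1
    exact e1.symm.trans e2
  have hfix : ∀ (L : IntermediateField K Ω) (hL : L ≤ L₁ ⊔ L₂) [IsAbelianGalois K L] (x : L),
      ((τ * σ)⁻¹ * (σ * τ)) (inclusion hL x) = inclusion hL x := by
    intro L hL _ x
    rw [AlgEquiv.mul_apply, key L hL x, ← AlgEquiv.mul_apply, inv_mul_cancel]
    rfl
  exact (inv_mul_eq_one.mp (algEquiv_sup_eq_one _ (hfix L₁ le_sup_left)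
    (hfix L₂ le_sup_right))).symm

/-- A stabiliser of an infinite place acts trivially on every normal subfield that is unramified
at the infinite places. -/
theorem gal_apply_algebraMap_eq_of_isUnramifiedAtInfinitePlaces {k E N : Type*} [Field k] [Field E]
    [Field N] [Algebra k E] [Algebra E N] [Algebra k N] [IsScalarTower k E N] [IsGalois k E]
    [IsUnramifiedAtInfinitePlaces k E] (w : NumberField.InfinitePlace N) (σ : Gal(N/k))
    (hσ : σ • w = w) (e : E) : σ (algebraMap E N e) = algebraMap E N e := by
  have h1 : σ.restrictNormal E ∈ MulAction.stabilizer Gal(E/k) (w.comap (algebraMap E N)) := by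
    rw [MulAction.mem_stabilizer_iff]
    apply DFunLike.ext
    intro x
    rw [NumberField.InfinitePlace.smul_apply, NumberField.InfinitePlace.comap_apply,
      NumberField.InfinitePlace.comap_apply]
    have h2 : algebraMap E N ((σ.restrictNormal E).symm x) = σ.symm (algebraMap E N x) := by
      apply σ.injective
      rw [← AlgEquiv.restrictNormal_commutes, AlgEquiv.apply_symm_apply, AlgEquiv.apply_symm_apply]
    rw [h2, ← NumberField.InfinitePlace.smul_apply, hσ]
  rw [(NumberField.InfinitePlace.isUnramified k (w.comap (algebraMap E N))).stabilizer_eq_bot,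
    Subgroup.mem_bot] at h1
  rw [← AlgEquiv.restrictNormal_commutes, h1]
  rfl

theorem IsUnramifiedAbelianExtension.sup [NumberField K] {L₁ L₂ : IntermediateField K Ω}
    (h₁ : IsUnramifiedAbelianExtension K L₁) (h₂ : IsUnramifiedAbelianExtension K L₂) :
    IsUnramifiedAbelianExtension K ↥(L₁ ⊔ L₂) := by
  have := h₁.finite
  have := h₂.finite
  have := h₁.abelian
  have := h₂.abelian
  have := h₁.unramified_infinite
  have := h₂.unramified_infinite
  have : NumberField L₁ := NumberField.of_module_finite K L₁
  have : NumberField L₂ := NumberField.of_module_finite K L₂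
  have hab := IntermediateField.isAbelianGalois_sup L₁ L₂
  have : FiniteDimensional K ↥(L₁ ⊔ L₂) := IntermediateField.finiteDimensional_sup L₁ L₂
  have : NumberField ↥(L₁ ⊔ L₂) := NumberField.of_module_finite K ↥(L₁ ⊔ L₂)
  refine ⟨inferInstance, hab, isUnramifiedIn_of_forall_inertia ?_, ⟨fun w => ?_⟩⟩
  · intro P σ hP hP0 hσ
    have key : ∀ (L : IntermediateField K Ω) (hL : L ≤ L₁ ⊔ L₂) [NumberField L] [IsGalois K L]
        (_ : ∀ v : IsDedekindDomain.HeightOneSpectrum (𝓞 K),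
          Algebra.IsUnramifiedIn (𝓞 L) v.asIdeal) (x : L),
        σ (IntermediateField.inclusion hL x) = IntermediateField.inclusion hL x := by
      intro L hL _ _ hunr x
      let _ : Algebra L ↥(L₁ ⊔ L₂) := (IntermediateField.inclusion hL).toAlgebra
      have : IsScalarTower K L ↥(L₁ ⊔ L₂) := IsScalarTower.of_algebraMap_eq' (by ext; rfl)
      have hQ0 : (P.under (𝓞 L)).under (𝓞 K) ≠ ⊥ :=
        Ideal.under_ne_bot (𝓞 K) (Ideal.under_ne_bot (𝓞 L) hP0)
      have hQ : Algebra.IsUnramifiedAt (𝓞 K) (P.under (𝓞 L)) :=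
        hunr ⟨_, inferInstance, hQ0⟩ _ inferInstance inferInstance
      refine gal_apply_algebraMap_eq_of_isUnramifiedAt (𝓞 K) P (σ : _ →ₐ[K] _) ?_ x
      intro x y hxy
      have : y = σ • x := NumberField.RingOfIntegers.ext hxy.symm
      rw [this]
      exact hσ x
    exact IntermediateField.algEquiv_sup_eq_one σ (key L₁ le_sup_left h₁.unramified_finite)
      (key L₂ le_sup_right h₂.unramified_finite)
  · rw [NumberField.InfinitePlace.isUnramified_iff_stabilizer_eq_bot, eq_bot_iff]
    intro σ hσ
    have key : ∀ (L : IntermediateField K Ω) (hL : L ≤ L₁ ⊔ L₂) [IsGalois K L]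
        [IsUnramifiedAtInfinitePlaces K L] (x : L),
        σ (IntermediateField.inclusion hL x) = IntermediateField.inclusion hL x := by
      intro L hL _ _ x
      let _ : Algebra L ↥(L₁ ⊔ L₂) := (IntermediateField.inclusion hL).toAlgebra
      have : IsScalarTower K L ↥(L₁ ⊔ L₂) := IsScalarTower.of_algebraMap_eq' (by ext; rfl)
      exact gal_apply_algebraMap_eq_of_isUnramifiedAtInfinitePlaces w σ hσ x
    exact IntermediateField.algEquiv_sup_eq_one σ (key L₁ le_sup_left) (key L₂ le_sup_right)

end Compositum

/-! ### Maximality of an unramified extension of prime degree equal to the class number -/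

/-- If `M / K` is an unramified abelian extension of prime degree `h_K`, then `M` is the Hilbert
class field of `K`. -/
theorem isHilbertClassField_of_finrank_eq_classNumber {K : Type} [Field K] [NumberField K]
    {Ω : Type} [Field Ω] [IsAlgClosed Ω] [Algebra K Ω] {M : IntermediateField K Ω} {p : ℕ}
    (hp : p.Prime) (hM : IsUnramifiedAbelianExtension K M) (hKM : Module.finrank K M = p)
    (hK : NumberField.classNumber K = p) : IsHilbertClassField K M := by
  refine ⟨hM, fun L hL => ?_⟩
  have hN := hL.sup hM
  have := Fact.mk hp
  have := hM.finite
  have := hM.abelian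
  have := hM.unramified_infinite
  have := hN.finite
  have := hN.abelian
  have := hN.unramified_infinite
  have : NumberField M := NumberField.of_module_finite K M
  have : NumberField ↥(L ⊔ M) := NumberField.of_module_finite K ↥(L ⊔ M)
  let _ : Algebra M ↥(L ⊔ M) := (IntermediateField.inclusion le_sup_right).toAlgebra
  have : IsScalarTower K M ↥(L ⊔ M) := IsScalarTower.of_algebraMap_eq' (by ext; rfl)
  have : IsAbelianGalois M ↥(L ⊔ M) := IsAbelianGalois.tower_top K M _
  have : IsUnramifiedAtInfinitePlaces M ↥(L ⊔ M) := IsUnramifiedAtInfinitePlaces.top K M _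
  have hmul := Module.finrank_mul_finrank K M ↥(L ⊔ M)
  have hone : Module.finrank M ↥(L ⊔ M) = 1 := by
    by_contra hne
    obtain ⟨ℓ, hℓ, hdvd⟩ := Nat.exists_prime_and_dvd hne
    -- A prime `ℓ` dividing `[LM : M]` also divides `[LM : K]`, hence `h_K = p`, which forces `ℓ =
    -- p`. Over `M` it divides `h_M`, which is prime to `p`.
    have h1 : ℓ ∣ NumberField.classNumber K :=
      prime_dvd_classNumber hN.unramified_finite hℓ (hmul ▸ hdvd.mul_left _)
    rw [hK, Nat.prime_dvd_prime_iff_eq hℓ hp] at h1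
    subst h1
    exact not_dvd_classNumber_of_classNumber_eq hM.unramified_finite hKM hK
      (prime_dvd_classNumber (isUnramifiedIn_top_of_tower (K := K) hN.unramified_finite) hℓ hdvd)
  rw [hone, mul_one] at hmul
  have heq : M = L ⊔ M := IntermediateField.eq_of_le_of_finrank_eq le_sup_right hmul
  rw [heq]
  exact le_sup_left

/-! ### Subgroups of index three and cubic characters -/

section IndexThree

local notation "C₃" => Multiplicative (ZMod 3)

theorem exists_monoidHom_ker_eq {G : Type*} [CommGroup G] {H : Subgroup G} (hH : H.index = 3) :
    ∃ χ : G →* C₃, Function.Surjective χ ∧ χ.ker = H := by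
  have := Fact.mk Nat.prime_three
  have e : G ⧸ H ≃* C₃ := mulEquivOfPrimeCardEq (p := 3) hH (by simp [Nat.card_eq_fintype_card])
  refine ⟨e.toMonoidHom.comp (QuotientGroup.mk' H),
    e.surjective.comp (QuotientGroup.mk'_surjective H), ?_⟩
  ext x
  simp

theorem index_ker_eq_three {G : Type*} [CommGroup G] {χ : G →* C₃} (hχ : Function.Surjective χ) :
    χ.ker.index = 3 := by
  rw [Subgroup.index_ker, MonoidHom.range_eq_top.mpr hχ, Subgroup.card_top]
  simp [Nat.card_eq_fintype_card]

theorem exists_pow_eq_of_isCyclic {A : Type*} [CommGroup A] [IsCyclic A] {α : A →* C₃}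
    (hα : Function.Surjective α) (χ : A →* C₃) : ∃ i < 3, χ = α ^ i := by
  obtain ⟨g, hg⟩ := IsCyclic.exists_generator (α := A)
  have hg1 : α g ≠ 1 := by
    intro h
    obtain ⟨x, hx⟩ := hα (Multiplicative.ofAdd 1)
    obtain ⟨n, rfl⟩ := hg x
    simp only [map_zpow, h, one_zpow] at hx
    exact absurd hx (by decide)
  have key : ∀ u v : C₃, u ≠ 1 → ∃ i < 3, v = u ^ i := by decide
  obtain ⟨i, hi, h⟩ := key _ (χ g) hg1
  refine ⟨i, hi, MonoidHom.ext fun x => ?_⟩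
  obtain ⟨n, rfl⟩ := hg x
  simp only [map_zpow, MonoidHom.pow_apply, h]

variable {G : Type*} [CommGroup G] {a b : G →* C₃}

/-- If every cubic character is a product of powers of two independent ones `a` and `b`, then
there are four subgroups of index three. -/
theorem setOf_index_eq_three (hs : ∀ u v : C₃, ∃ g, a g = u ∧ b g = v)
    (hall : ∀ χ : G →* C₃, ∃ i < 3, ∃ j < 3, χ = a ^ i * b ^ j) :
    {H : Subgroup G | H.index = 3} = {a.ker, b.ker, (a * b).ker, (a * b⁻¹).ker} := by
  ext H
  simp only [Set.mem_ofPred_eq, Set.mem_insert_iff, Set.mem_singleton_iff]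
  constructor
  · intro hH
    obtain ⟨χ, hχ, rfl⟩ := exists_monoidHom_ker_eq hH
    obtain ⟨i, hi, j, hj, rfl⟩ := hall χ
    -- The eight nonzero exponent pairs fall into four pairs of mutually inverse characters, which
    -- share their kernel.
    have e1 : ∀ u v : C₃, (u ^ 1 * v ^ 0 = 1 ↔ u = 1) ∧ (u ^ 2 * v ^ 0 = 1 ↔ u = 1) ∧
      (u ^ 0 * v ^ 1 = 1 ↔ v = 1) ∧ (u ^ 0 * v ^ 2 = 1 ↔ v = 1) ∧
      (u ^ 1 * v ^ 1 = 1 ↔ u * v = 1) ∧ (u ^ 2 * v ^ 2 = 1 ↔ u * v = 1) ∧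
      (u ^ 1 * v ^ 2 = 1 ↔ u * v⁻¹ = 1) ∧ (u ^ 2 * v ^ 1 = 1 ↔ u * v⁻¹ = 1) := by decide
    interval_cases i <;> interval_cases j
    · obtain ⟨g, hg⟩ := hχ (Multiplicative.ofAdd 1)
      simp only [pow_zero, mul_one, MonoidHom.one_apply] at hg
      exact absurd hg (by decide)
    · exact .inr (.inl (Subgroup.ext fun g => (e1 (a g) (b g)).2.2.1))
    · exact .inr (.inl (Subgroup.ext fun g => (e1 (a g) (b g)).2.2.2.1))
    · exact .inl (Subgroup.ext fun g => (e1 (a g) (b g)).1)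
    · exact .inr (.inr (.inl (Subgroup.ext fun g => (e1 (a g) (b g)).2.2.2.2.1)))
    · exact .inr (.inr (.inr (Subgroup.ext fun g => (e1 (a g) (b g)).2.2.2.2.2.2.1)))
    · exact .inl (Subgroup.ext fun g => (e1 (a g) (b g)).2.1)
    · exact .inr (.inr (.inr (Subgroup.ext fun g => (e1 (a g) (b g)).2.2.2.2.2.2.2)))
    · exact .inr (.inr (.inl (Subgroup.ext fun g => (e1 (a g) (b g)).2.2.2.2.2.1)))
  · rintro (rfl | rfl | rfl | rfl) <;> apply index_ker_eq_three <;> intro u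
    · obtain ⟨g, hg, -⟩ := hs u 1
      exact ⟨g, hg⟩
    · obtain ⟨g, -, hg⟩ := hs 1 u
      exact ⟨g, hg⟩
    · obtain ⟨g, hg, hg'⟩ := hs u 1
      exact ⟨g, by simp [hg, hg']⟩
    · obtain ⟨g, hg, hg'⟩ := hs u 1
      exact ⟨g, by simp [hg, hg']⟩

theorem ker_mul_ne_ker_mul_inv (hs : ∀ u v : C₃, ∃ g, a g = u ∧ b g = v) :
    (a * b).ker ≠ (a * b⁻¹).ker := by
  obtain ⟨g, h1, h2⟩ := hs (Multiplicative.ofAdd 1) (Multiplicative.ofAdd 1)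
  intro h
  have h3 : g ∈ (a * b⁻¹).ker := by simp [MonoidHom.mem_ker, h1, h2]
  rw [← h, MonoidHom.mem_ker, MonoidHom.mul_apply, h1, h2] at h3
  exact absurd h3 (by decide)

/-- The index of the intersection of the kernels of two independent cubic characters. -/
theorem index_ker_inf_ker (hs : ∀ u v : C₃, ∃ g, a g = u ∧ b g = v) :
    (a.ker ⊓ b.ker).index = 9 := by
  have hk : a.ker ⊓ b.ker = (a.prod b).ker := by
    ext g; simp [MonoidHom.mem_ker, Prod.ext_iff]
  have hsurj : Function.Surjective (a.prod b) := by
    rintro ⟨u, v⟩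
    obtain ⟨g, h1, h2⟩ := hs u v
    exact ⟨g, Prod.ext h1 h2⟩
  rw [hk, Subgroup.index_ker, MonoidHom.range_eq_top.mpr hsurj, Subgroup.card_top]
  simp [Nat.card_eq_fintype_card]

/-- A product of two cyclic groups of order divisible by three has two independent cubic characters,
one for each factor, that generate all cubic characters. -/
theorem exists_cubic_characters {A B : Type*} [CommGroup A] [CommGroup B] [Finite A] [Finite B]
    [IsCyclic A] [IsCyclic B] (hA : 3 ∣ Nat.card A) (hB : 3 ∣ Nat.card B) (e : G ≃* A × B) :
    ∃ a b : G →* C₃, (∀ u v : C₃, ∃ g, a g = u ∧ b g = v) ∧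
      (∀ χ : G →* C₃, ∃ i < 3, ∃ j < 3, χ = a ^ i * b ^ j) ∧
      (∀ g, (e g).1 = 1 → a g = 1) ∧ (∃ g, (e g).1 = 1 ∧ b g ≠ 1) ∧
      (∀ g, (e g).2 = 1 → b g = 1) ∧ (∃ g, (e g).2 = 1 ∧ a g ≠ 1) := by
  have := Fact.mk Nat.prime_three
  obtain ⟨HA, hHA⟩ := exists_subgroup_index_eq_prime hA
  obtain ⟨HB, hHB⟩ := exists_subgroup_index_eq_prime hB
  obtain ⟨α, hα, -⟩ := exists_monoidHom_ker_eq hHA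
  obtain ⟨β, hβ, -⟩ := exists_monoidHom_ker_eq hHB
  refine ⟨(α.comp (MonoidHom.fst A B)).comp e.toMonoidHom,
    (β.comp (MonoidHom.snd A B)).comp e.toMonoidHom, ?_, ?_, ?_, ?_, ?_, ?_⟩
  · intro u v
    obtain ⟨x, hx⟩ := hα u
    obtain ⟨y, hy⟩ := hβ v
    exact ⟨e.symm (x, y), by simp [hx], by simp [hy]⟩
  · intro χ
    let χ' : A × B →* C₃ := χ.comp e.symm.toMonoidHom
    obtain ⟨i, hi, h1⟩ := exists_pow_eq_of_isCyclic hα (χ'.comp (MonoidHom.inl A B))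
    obtain ⟨j, hj, h2⟩ := exists_pow_eq_of_isCyclic hβ (χ'.comp (MonoidHom.inr A B))
    refine ⟨i, hi, j, hj, MonoidHom.ext fun g => ?_⟩
    have h3 : χ g = χ' (e g) := by simp [χ']
    have h4 : e g = ((e g).1, 1) * (1, (e g).2) := by simp
    have h5 := DFunLike.congr_fun h1 (e g).1
    have h6 := DFunLike.congr_fun h2 (e g).2
    rw [h3, h4, map_mul]
    simp only [MonoidHom.comp_apply, MonoidHom.inl_apply, MonoidHom.inr_apply] at h5 h6
    rw [h5, h6]
    simp
  · intro g hg
    simp [hg]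
  · obtain ⟨y, hy⟩ := hβ (Multiplicative.ofAdd 1)
    exact ⟨e.symm (1, y), by simp, by simp [hy]⟩
  · intro g hg
    simp [hg]
  · obtain ⟨y, hy⟩ := hα (Multiplicative.ofAdd 1)
    exact ⟨e.symm (y, 1), by simp, by simp [hy]⟩

/-- The subgroups of index three of a product of two cyclic groups of order divisible by three:
`N` and `N'` are the kernels of the two projections. -/
theorem exists_subgroups_index_eq_three {A B : Type*} [CommGroup A] [CommGroup B]
    [Finite A] [Finite B] [IsCyclic A] [IsCyclic B] (hA : 3 ∣ Nat.card A) (hB : 3 ∣ Nat.card B)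
    (e : G ≃* A × B) {N N' : Subgroup G} (hN : ∀ g, g ∈ N ↔ (e g).1 = 1)
    (hN' : ∀ g, g ∈ N' ↔ (e g).2 = 1) :
    {H : Subgroup G | H.index = 3}.ncard = 4 ∧
    {H : Subgroup G | H.index = 3 ∧ ¬ N ≤ H ∧ ¬ N' ≤ H}.ncard = 2 ∧
    ∃ X X' : Subgroup G, {H | N ≤ H ∧ H.index = 3} = {X} ∧ {H | N' ≤ H ∧ H.index = 3} = {X'} ∧
      (X ⊓ X').index = 9 ∧ ∀ H : Subgroup G, H.index = 3 → ¬ N ≤ H → ¬ N' ≤ H →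
        H ⊓ X = X ⊓ X' ∧ H ⊓ X' = X ⊓ X' := by
  obtain ⟨a, b, hs, hall, ha, ⟨g, hg, hbg⟩, hb, ⟨g', hg', hag'⟩⟩ := exists_cubic_characters hA hB e
  have hset := setOf_index_eq_three hs hall
  have hiff (H : Subgroup G) : H.index = 3 ↔
      H = a.ker ∨ H = b.ker ∨ H = (a * b).ker ∨ H = (a * b⁻¹).ker :=
    Set.ext_iff.mp hset H
  have hag : a g = 1 := ha g hg
  have hbg' : b g' = 1 := hb g' hg'
  have h1 : N ≤ a.ker := fun x hx => ha x ((hN x).mp hx)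
  have h2 : N' ≤ b.ker := fun x hx => hb x ((hN' x).mp hx)
  have not_le {χ : G →* C₃} (h : χ g ≠ 1) : ¬ N ≤ χ.ker := fun hle => h (hle ((hN g).mpr hg))
  have not_le' {χ : G →* C₃} (h : χ g' ≠ 1) : ¬ N' ≤ χ.ker :=
    fun hle => h (hle ((hN' g').mpr hg'))
  have hb1 : ¬ N ≤ b.ker := not_le hbg
  have ha2 : ¬ N' ≤ a.ker := not_le' hag'
  have hc1 : ¬ N ≤ (a * b).ker := not_le (by simpa [hag] using hbg)
  have hc2 : ¬ N' ≤ (a * b).ker := not_le' (by simpa [hbg'] using hag')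
  have hd1 : ¬ N ≤ (a * b⁻¹).ker := not_le (by simpa [hag] using hbg)
  have hd2 : ¬ N' ≤ (a * b⁻¹).ker := not_le' (by simpa [hbg'] using hag')
  have hcd := ker_mul_ne_ker_mul_inv hs
  have hab : a.ker ≠ b.ker := fun h => hb1 (h ▸ h1)
  have hac : a.ker ≠ (a * b).ker := fun h => hc1 (h ▸ h1)
  have had : a.ker ≠ (a * b⁻¹).ker := fun h => hd1 (h ▸ h1)
  have hbc : b.ker ≠ (a * b).ker := fun h => hc2 (h ▸ h2)
  have hbd : b.ker ≠ (a * b⁻¹).ker := fun h => hd2 (h ▸ h2)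
  refine ⟨?_, ?_, a.ker, b.ker, ?_, ?_, index_ker_inf_ker hs, fun H hH hH1 hH2 => ?_⟩
  · rw [hset, Set.ncard_insert_of_notMem, Set.ncard_insert_of_notMem, Set.ncard_pair hcd]
    · simp [hbc, hbd]
    · simp [hab, hac, had]
  · rw [← Set.ncard_pair hcd]
    congr 1
    ext H
    simp only [Set.mem_ofPred_eq, Set.mem_insert_iff, Set.mem_singleton_iff, hiff]
    constructor
    · rintro ⟨rfl | rfl | h, h3, h4⟩
      exacts [absurd h1 h3, absurd h2 h4, h]
    · rintro (rfl | rfl)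
      exacts [⟨.inr (.inr (.inl rfl)), hc1, hc2⟩, ⟨.inr (.inr (.inr rfl)), hd1, hd2⟩]
  · ext H
    simp only [Set.mem_ofPred_eq, Set.mem_singleton_iff, hiff]
    constructor
    · rintro ⟨h, rfl | rfl | rfl | rfl⟩
      exacts [rfl, absurd h hb1, absurd h hc1, absurd h hd1]
    · rintro rfl
      exact ⟨h1, .inl rfl⟩
  · ext H
    simp only [Set.mem_ofPred_eq, Set.mem_singleton_iff, hiff]
    constructor
    · rintro ⟨h, rfl | rfl | rfl | rfl⟩
      exacts [absurd h ha2, rfl, absurd h hc2, absurd h hd2]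
    · rintro rfl
      exact ⟨h2, .inr (.inl rfl)⟩
  · rcases (hiff H).mp hH with rfl | rfl | rfl | rfl
    · exact absurd h1 hH1
    · exact absurd h2 hH2
    -- For `H` the kernel of `a * b` or `a * b⁻¹`, an element on which two of this character, `a`
    -- and `b` vanish is killed by the third.
    all_goals
      constructor <;> ext x <;>
        simp only [Subgroup.mem_inf, MonoidHom.mem_ker, MonoidHom.mul_apply, MonoidHom.inv_apply] <;>
        constructor <;> rintro ⟨h, h'⟩ <;> simp_all

end IndexThree

/-! ### Galois correspondence for subfields of a fixed large field -/

namespace IntermediateField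

variable {k Ω : Type*} [Field k] [Field Ω] [Algebra k Ω] {F : IntermediateField k Ω}

/-- The Galois group of a subextension `F` of `Ω / k`. -/
abbrev Aut (F : IntermediateField k Ω) : Type _ := Gal(F/k)

/-- The subfield of `Ω` fixed by a group of automorphisms of `F ≤ Ω`. -/
noncomputable def liftFixed (H : Subgroup Gal(F/k)) : IntermediateField k Ω :=
  lift (fixedField H)

theorem liftFixed_le (H : Subgroup Gal(F/k)) : liftFixed H ≤ F := lift_le _

variable [FiniteDimensional k F]

theorem finrank_liftFixed [IsGalois k F] (H : Subgroup Gal(F/k)) :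
    Module.finrank k (liftFixed H) = H.index := by
  rw [← fixingSubgroup_fixedField H, ← finrank_eq_fixingSubgroup_index, fixingSubgroup_fixedField]
  exact (liftAlgEquiv (fixedField H)).toLinearEquiv.finrank_eq.symm

theorem liftFixed_le_liftFixed_iff {H H' : Subgroup Gal(F/k)} :
    liftFixed H ≤ liftFixed H' ↔ H' ≤ H := by
  have h : lift (fixedField H) ≤ lift (fixedField H') ↔ fixedField H ≤ fixedField H' := by
    refine ⟨fun h x hx => ?_, fun h => map_mono _ h⟩
    obtain ⟨y, hy, hxy⟩ := h ⟨x, hx, rfl⟩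
    have : y = x := Subtype.ext hxy
    exact this ▸ hy
  rw [liftFixed, liftFixed, h, le_iff_le, fixingSubgroup_fixedField]

theorem liftFixed_injective : Function.Injective (liftFixed (F := F)) := by
  intro H H' h
  exact le_antisymm (liftFixed_le_liftFixed_iff.mp h.ge) (liftFixed_le_liftFixed_iff.mp h.le)

theorem exists_liftFixed_eq [IsGalois k F] {K : IntermediateField k Ω} (hK : K ≤ F) :
    ∃ H : Subgroup Gal(F/k), liftFixed H = K := by
  refine ⟨(restrict hK).fixingSubgroup, ?_⟩
  rw [liftFixed, IsGalois.fixedField_fixingSubgroup, lift_restrict]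

theorem liftFixed_inf [IsGalois k F] (H H' : Subgroup Gal(F/k)) :
    liftFixed (H ⊓ H') = liftFixed H ⊔ liftFixed H' := by
  apply le_antisymm
  · obtain ⟨S, hS⟩ := exists_liftFixed_eq (sup_le (liftFixed_le H) (liftFixed_le H'))
    rw [← hS, liftFixed_le_liftFixed_iff]
    refine le_inf ?_ ?_
    · rw [← liftFixed_le_liftFixed_iff, hS]
      exact le_sup_left
    · rw [← liftFixed_le_liftFixed_iff, hS]
      exact le_sup_right
  · exact sup_le (liftFixed_le_liftFixed_iff.mpr inf_le_left)
      (liftFixed_le_liftFixed_iff.mpr inf_le_right)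

/-- An automorphism fixes `k(z)` exactly when it fixes `z`, so `H` is the group attached to `k(z)`.
-/
theorem liftFixed_eq_adjoin [IsGalois k F] {H : Subgroup Gal(F/k)} (z : F)
    (h : ∀ σ, σ ∈ H ↔ σ z = z) : liftFixed H = adjoin k {(z : Ω)} := by
  have hle : adjoin k {(z : Ω)} ≤ F := adjoin_simple_le_iff.mpr z.2
  obtain ⟨H', hH'⟩ := exists_liftFixed_eq hle
  rw [← hH']
  congr 1
  ext σ
  have hfix : z ∈ fixedField (Subgroup.zpowers σ) ↔ σ z = z := by
    rw [mem_fixedField_iff]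
    refine ⟨fun h => h σ (Subgroup.mem_zpowers σ), fun h τ hτ => ?_⟩
    have : Subgroup.zpowers σ ≤ MulAction.stabilizer Gal(F/k) z := Subgroup.zpowers_le.mpr h
    exact this hτ
  rw [h, ← hfix, ← Subgroup.zpowers_le, ← liftFixed_le_liftFixed_iff, hH', adjoin_simple_le_iff]
  exact (mem_lift z).symm

theorem setOf_le_and_finrank_eq [IsGalois k F] (n : ℕ) :
    {K : IntermediateField k Ω | K ≤ F ∧ Module.finrank k K = n} =
      Set.image liftFixed {H : Subgroup Gal(F/k) | H.index = n} := by
  ext K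
  constructor
  · rintro ⟨h1, h2⟩
    obtain ⟨H, rfl⟩ := exists_liftFixed_eq h1
    exact ⟨H, (finrank_liftFixed H).symm.trans h2, rfl⟩
  · rintro ⟨H, hH, rfl⟩
    exact ⟨liftFixed_le H, (finrank_liftFixed H).trans hH⟩

end IntermediateField

/-! ### Galois groups of cyclotomic fields -/

section Cyclotomic

theorem isPrimitiveRoot_exp {n : ℕ} (hn : n ≠ 0) :
    IsPrimitiveRoot (Complex.exp (2 * Real.pi * Complex.I / n)) n :=
  Complex.isPrimitiveRoot_exp n hn

instance isCyclotomicExtension_cyclotomicSubfield (n : ℕ) [NeZero n] :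
    IsCyclotomicExtension {n} ℚ (cyclotomicSubfield n) := by
  have hζ := isPrimitiveRoot_exp (NeZero.ne n)
  have h : (cyclotomicSubfield n).toSubalgebra =
      Algebra.adjoin ℚ {Complex.exp (2 * Real.pi * Complex.I / n)} :=
    IntermediateField.adjoin_simple_toSubalgebra_of_isAlgebraic
      ((hζ.isIntegral (NeZero.pos n)).tower_top (A := ℚ)).isAlgebraic
  change IsCyclotomicExtension {n} ℚ (cyclotomicSubfield n).toSubalgebra
  rw [h]
  exact hζ.adjoin_isCyclotomicExtension ℚ

instance numberField_cyclotomicSubfield (n : ℕ) [NeZero n] : NumberField (cyclotomicSubfield n) :=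
  IsCyclotomicExtension.numberField {n} ℚ _

instance isAbelianGalois_cyclotomicSubfield (n : ℕ) [NeZero n] :
    IsAbelianGalois ℚ (cyclotomicSubfield n) :=
  IsCyclotomicExtension.isAbelianGalois {n} ℚ _

/-- Here the `ℚ`-algebra structure is explicitly the one of an intermediate field, as in the Galois
correspondence above. -/
instance isGalois_cyclotomicSubfield (n : ℕ) [NeZero n] :
    @IsGalois ℚ _ (cyclotomicSubfield n) _ (IntermediateField.algebra' _) :=
  (isAbelianGalois_cyclotomicSubfield n).toIsGalois

instance finiteDimensional_cyclotomicSubfield (n : ℕ) [NeZero n] :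
    @FiniteDimensional ℚ (cyclotomicSubfield n) _ _ (IntermediateField.module' _) :=
  NumberField.to_finiteDimensional

theorem cyclotomicSubfield_le {m n : ℕ} (hn : n ≠ 0) (h : m ∣ n) :
    cyclotomicSubfield m ≤ cyclotomicSubfield n := by
  obtain ⟨d, rfl⟩ := h
  rw [cyclotomicSubfield, IntermediateField.adjoin_simple_le_iff]
  have hd : (d : ℂ) ≠ 0 := by
    rintro h; simp_all
  have : Complex.exp (2 * Real.pi * Complex.I / m) =
      Complex.exp (2 * Real.pi * Complex.I / (m * d : ℕ)) ^ d := by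
    rw [← Complex.exp_nat_mul]
    congr 1
    push_cast
    by_cases hm : (m : ℂ) = 0
    · simp [hm]
    · field_simp
  rw [this]
  exact pow_mem (IntermediateField.mem_adjoin_simple_self ℚ _) d

/-- The Galois group of `ℚ(ζ_n)` is `(ℤ/n)ˣ`; here `ℚ(ζ_n)` has its structure of `ℚ`-algebra as a
subfield of `ℂ`. -/
noncomputable def cyclotomicGalEquiv (n : ℕ) [NeZero n] :
    (cyclotomicSubfield n).Aut ≃* (ZMod n)ˣ :=
  IsCyclotomicExtension.Rat.galEquivZMod n (cyclotomicSubfield n)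

/-- The field `ℚ(ζ_m)`, for `m ∣ n`, is the subfield of `ℚ(ζ_n)` fixed by the kernel of
`Gal(ℚ(ζ_n)/ℚ) → (ℤ/m)ˣ`. -/
theorem liftFixed_eq_cyclotomicSubfield {m n : ℕ} [NeZero m] [NeZero n] (h : m ∣ n)
    {H : Subgroup (cyclotomicSubfield n).Aut} (hH : ∀ σ, σ ∈ H ↔ ZMod.unitsMap h (cyclotomicGalEquiv n σ) = 1) :
    IntermediateField.liftFixed H = cyclotomicSubfield m := by
  have hle := cyclotomicSubfield_le (NeZero.ne n) h
  have hζ := isPrimitiveRoot_exp (NeZero.ne m)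
  have hmem : Complex.exp (2 * Real.pi * Complex.I / m) ∈ cyclotomicSubfield n :=
    hle (IntermediateField.mem_adjoin_simple_self ℚ _)
  let z : cyclotomicSubfield n := ⟨Complex.exp (2 * Real.pi * Complex.I / m), hmem⟩
  have hz : IsPrimitiveRoot z m :=
    IsPrimitiveRoot.of_map_of_injective (f := algebraMap (cyclotomicSubfield n) ℂ) hζ
      (FaithfulSMul.algebraMap_injective _ ℂ)
  have hzn : z ^ n = 1 := (hz.pow_eq_one_iff_dvd n).mpr h
  -- If `σ` corresponds to `c` modulo `n`, then `σ z = z ^ c`, which is `z` exactly when `c` is 1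
  -- modulo `m`, the order of `z`.
  have hσ (σ : Gal(cyclotomicSubfield n/ℚ)) : σ z = z ↔ ZMod.unitsMap h
      (IsCyclotomicExtension.Rat.galEquivZMod n (cyclotomicSubfield n) σ) = 1 := by
    rw [IsCyclotomicExtension.Rat.galEquivZMod_apply_of_pow_eq n _ σ hzn]
    nth_rw 2 [← pow_one z]
    rw [(hz.isOfFinOrder (NeZero.ne _)).pow_inj_mod, ← hz.eq_orderOf,
      ← ZMod.natCast_eq_natCast_iff', ZMod.natCast_val, Units.ext_iff, Nat.cast_one]
    rfl
  exact IntermediateField.liftFixed_eq_adjoin z fun σ => (hH σ).trans (hσ σ).symm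

/-- The isomorphism `Gal(ℚ(ζ_mn)/ℚ) ≃ (ℤ/m)ˣ × (ℤ/n)ˣ` for coprime `m` and `n`. -/
theorem exists_cyclotomicGalEquiv_prod {m n : ℕ} [NeZero m] [NeZero n] (h : m.Coprime n) :
    ∃ (e : (cyclotomicSubfield (m * n)).Aut ≃* (ZMod m)ˣ × (ZMod n)ˣ)
      (N N' : Subgroup (cyclotomicSubfield (m * n)).Aut),
      (∀ σ, σ ∈ N ↔ (e σ).1 = 1) ∧ (∀ σ, σ ∈ N' ↔ (e σ).2 = 1) ∧
      IntermediateField.liftFixed N = cyclotomicSubfield m ∧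
      IntermediateField.liftFixed N' = cyclotomicSubfield n := by
  let f : (ZMod (m * n))ˣ ≃* (ZMod m)ˣ × (ZMod n)ˣ :=
    (Units.mapEquiv (ZMod.chineseRemainder h).toMulEquiv).trans MulEquiv.prodUnits
  have hf1 (u) : (f u).1 = ZMod.unitsMap (dvd_mul_right m n) u := by
    ext
    exact RingHom.congr_fun (Subsingleton.elim
      ((RingHom.fst _ _).comp (ZMod.chineseRemainder h : ZMod (m * n) →+* ZMod m × ZMod n))
      (ZMod.castHom (dvd_mul_right m n) (ZMod m))) (u : ZMod (m * n))
  have hf2 (u) : (f u).2 = ZMod.unitsMap (dvd_mul_left n m) u := by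
    ext
    exact RingHom.congr_fun (Subsingleton.elim
      ((RingHom.snd _ _).comp (ZMod.chineseRemainder h : ZMod (m * n) →+* ZMod m × ZMod n))
      (ZMod.castHom (dvd_mul_left n m) (ZMod n))) (u : ZMod (m * n))
  let e := (cyclotomicGalEquiv (m * n)).trans f
  refine ⟨e, ((MonoidHom.fst _ _).comp e.toMonoidHom).ker, ((MonoidHom.snd _ _).comp
    e.toMonoidHom).ker, fun _ => Iff.rfl, fun _ => Iff.rfl,
    liftFixed_eq_cyclotomicSubfield (dvd_mul_right m n) fun σ => ?_,
    liftFixed_eq_cyclotomicSubfield (dvd_mul_left n m) fun σ => ?_⟩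
  · rw [← hf1]
    rfl
  · rw [← hf2]
    rfl

end Cyclotomic

/-! ### From subgroups of index three to cubic fields -/

section CubicSubfields

open IntermediateField

variable {k Ω : Type*} [Field k] [Field Ω] [Algebra k Ω] {F : IntermediateField k Ω}
  [FiniteDimensional k F] [IsGalois k F]

/-- The cubic subfields of an extension with Galois group a product of two cyclic groups of order
divisible by three. -/
theorem exists_cubic_subfields {A B : Type*} [CommGroup A] [CommGroup B]
    [Finite A] [Finite B] [IsCyclic A] [IsCyclic B] (hA : 3 ∣ Nat.card A) (hB : 3 ∣ Nat.card B)
    (e : Gal(F/k) ≃* A × B) {N N' : Subgroup Gal(F/k)} (hN : ∀ g, g ∈ N ↔ (e g).1 = 1)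
    (hN' : ∀ g, g ∈ N' ↔ (e g).2 = 1) :
    {K | K ≤ F ∧ Module.finrank k K = 3}.ncard = 4 ∧
    {K | (K ≤ F ∧ Module.finrank k K = 3) ∧ ¬ K ≤ liftFixed N ∧ ¬ K ≤ liftFixed N'}.ncard = 2 ∧
    ∃ K₁ K₂ : IntermediateField k Ω,
      {K | K ≤ liftFixed N ∧ Module.finrank k K = 3} = {K₁} ∧
      {K | K ≤ liftFixed N' ∧ Module.finrank k K = 3} = {K₂} ∧
      Module.finrank k ↥(K₁ ⊔ K₂) = 9 ∧
      ∀ K, (K ≤ F ∧ Module.finrank k K = 3) → ¬ K ≤ liftFixed N → ¬ K ≤ liftFixed N' →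
        K ⊔ K₁ = K₁ ⊔ K₂ ∧ K ⊔ K₂ = K₁ ⊔ K₂ := by
  obtain ⟨h4, h2, X, X', hX, hX', h9, h⟩ :=
    letI : CommGroup Gal(F/k) :=
      { mul_comm := fun a b => e.injective (by rw [map_mul, map_mul, mul_comm]) }
    exists_subgroups_index_eq_three hA hB e hN hN'
  have hset := setOf_le_and_finrank_eq (F := F) 3
  have key (S : Subgroup Gal(F/k)) : {K | K ≤ liftFixed S ∧ Module.finrank k K = 3} =
      Set.image liftFixed {H : Subgroup Gal(F/k) | S ≤ H ∧ H.index = 3} := by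
    ext K
    constructor
    · rintro ⟨h, h'⟩
      obtain ⟨H, rfl⟩ := exists_liftFixed_eq (h.trans (liftFixed_le S))
      exact ⟨H, ⟨liftFixed_le_liftFixed_iff.mp h, finrank_liftFixed H ▸ h'⟩, rfl⟩
    · rintro ⟨H, ⟨h, h'⟩, rfl⟩
      exact ⟨liftFixed_le_liftFixed_iff.mpr h, (finrank_liftFixed H).trans h'⟩
  refine ⟨?_, ?_, liftFixed X, liftFixed X', ?_, ?_, ?_, ?_⟩
  · rw [hset, Set.ncard_image_of_injective _ liftFixed_injective, h4]
  · rw [← h2, ← Set.ncard_image_of_injective _ (liftFixed_injective (F := F))]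
    congr 1
    ext K
    constructor
    · rintro ⟨⟨h, h'⟩, h3, h4⟩
      obtain ⟨H, rfl⟩ := exists_liftFixed_eq h
      rw [liftFixed_le_liftFixed_iff] at h3 h4
      exact ⟨H, ⟨finrank_liftFixed H ▸ h', h3, h4⟩, rfl⟩
    · rintro ⟨H, ⟨h, h3, h4⟩, rfl⟩
      rw [← liftFixed_le_liftFixed_iff] at h3 h4
      exact ⟨⟨liftFixed_le H, (finrank_liftFixed H).trans h⟩, h3, h4⟩
  · rw [key, hX, Set.image_singleton]
  · rw [key, hX', Set.image_singleton]
  · rw [← liftFixed_inf, finrank_liftFixed, h9]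
  · rintro K ⟨hK, hK3⟩ h5 h6
    obtain ⟨H, rfl⟩ := exists_liftFixed_eq hK
    rw [finrank_liftFixed] at hK3
    rw [liftFixed_le_liftFixed_iff] at h5 h6
    rw [← liftFixed_inf, ← liftFixed_inf, ← liftFixed_inf, (h H hK3 h5 h6).1, (h H hK3 h5 h6).2]
    exact ⟨rfl, rfl⟩

end CubicSubfields

/-! ### Ramification in subfields of cyclotomic fields -/

section Unramified

/-- A subfield of `ℚ(ζ_m)` is unramified at the primes that do not divide `m`. -/
theorem isUnramifiedAt_int_of_isCyclotomicExtension {E C : Type*} [Field E] [Field C]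
    [NumberField E] [NumberField C] [Algebra E C] {m : ℕ} [NeZero m]
    [IsCyclotomicExtension {m} ℚ C] {r : ℕ} (hr : r.Prime) (hrm : ¬ r ∣ m) (Q : Ideal (𝓞 E))
    [Q.IsPrime] [Q.LiesOver (Ideal.span {(r : ℤ)})] : Algebra.IsUnramifiedAt ℤ Q := by
  have := Fact.mk hr
  obtain ⟨⟨P, hP, hPQ⟩⟩ := Q.nonempty_primesOver (S := 𝓞 C)
  have : P.LiesOver (Ideal.span {(r : ℤ)}) := .trans P Q _
  have h1 := IsCyclotomicExtension.Rat.ramificationIdx_eq_of_not_dvd r C P hrm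
  have h0 : P.under ℤ ≠ ⊥ := by
    rw [← ‹P.LiesOver (Ideal.span {(r : ℤ)})›.over]
    simpa using hr.ne_zero
  have : (P.under ℤ).IsMaximal := Ideal.IsPrime.isMaximal inferInstance h0
  have : Algebra.IsUnramifiedAt ℤ P := by
    rwa [Ideal.ramificationIdx_eq_one_iff] at h1
  exact Algebra.IsUnramifiedAt.of_liesOver ℤ Q P

/-- An automorphism in the inertia group of a prime `P` of `N` fixes the subfields of a cyclotomic
field whose conductor is not in `P`. -/
theorem gal_apply_algebraMap_eq_of_isCyclotomicExtension {N E C : Type*} [Field N] [Field E]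
    [Field C] [NumberField N] [NumberField E] [NumberField C] [Algebra E N] [Algebra E C]
    [IsGalois ℚ E] {m : ℕ} [NeZero m] [IsCyclotomicExtension {m} ℚ C] {r : ℕ} (hr : r.Prime)
    (hrm : ¬ r ∣ m) (P : Ideal (𝓞 N)) [P.IsPrime] [P.LiesOver (Ideal.span {(r : ℤ)})]
    (σ : N →ₐ[ℚ] N) (hσ : ∀ x y : 𝓞 N, σ x = y → y - x ∈ P) (e : E) :
    σ (algebraMap E N e) = algebraMap E N e := by
  have : (P.under (𝓞 E)).LiesOver (Ideal.span {(r : ℤ)}) := Ideal.LiesOver.tower_bot P _ _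
  have := isUnramifiedAt_int_of_isCyclotomicExtension (C := C) hr hrm (P.under (𝓞 E))
  exact gal_apply_algebraMap_eq_of_isUnramifiedAt ℤ P σ hσ e

/-- A Galois extension `N / K` that is generated by each of two Galois extensions of `ℚ` which
are contained in cyclotomic fields of coprime conductors is unramified. -/
theorem isUnramifiedIn_of_forall_fixes {K N E₁ E₂ C₁ C₂ : Type*} [Field K] [Field N] [Field E₁]
    [Field E₂] [Field C₁] [Field C₂] [NumberField K] [NumberField N] [NumberField E₁]
    [NumberField E₂] [NumberField C₁] [NumberField C₂] [Algebra K N] [Algebra E₁ N] [Algebra E₂ N]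
    [Algebra E₁ C₁] [Algebra E₂ C₂] [IsGalois K N] [IsGalois ℚ E₁] [IsGalois ℚ E₂] {m n : ℕ}
    [NeZero m] [NeZero n] (hmn : m.Coprime n) [IsCyclotomicExtension {m} ℚ C₁]
    [IsCyclotomicExtension {n} ℚ C₂]
    (h₁ : ∀ σ : Gal(N/K), (∀ x : E₁, σ (algebraMap E₁ N x) = algebraMap E₁ N x) → σ = 1)
    (h₂ : ∀ σ : Gal(N/K), (∀ x : E₂, σ (algebraMap E₂ N x) = algebraMap E₂ N x) → σ = 1)
    (v : IsDedekindDomain.HeightOneSpectrum (𝓞 K)) : Algebra.IsUnramifiedIn (𝓞 N) v.asIdeal := by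
  refine isUnramifiedIn_of_forall_inertia (fun P σ hP hP0 hσ => ?_) v
  have hin : ∀ x y : 𝓞 N, (σ.toAlgHom.restrictScalars ℚ) x = y → y - x ∈ P := by
    intro x y hxy
    have : y = σ • x := by
      apply NumberField.RingOfIntegers.coe_injective
      exact hxy.symm
    exact this ▸ hσ x
  have : NeZero P := ⟨hP0⟩
  have hr : (Ideal.absNorm (P.under ℤ)).Prime := Nat.absNorm_under_prime P
  have : P.LiesOver (Ideal.span {(Ideal.absNorm (P.under ℤ) : ℤ)}) := inferInstance
  -- The residue characteristic divides at most one of the coprime conductors, so `σ` fixes the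
  -- field with the other conductor, which generates `N` over `K`.
  by_cases hrm : Ideal.absNorm (P.under ℤ) ∣ m
  · have hrn : ¬ Ideal.absNorm (P.under ℤ) ∣ n := fun h =>
      hr.ne_one (Nat.eq_one_of_dvd_coprimes hmn hrm h)
    exact h₂ σ (gal_apply_algebraMap_eq_of_isCyclotomicExtension (C := C₂) hr hrn P
      (σ.toAlgHom.restrictScalars ℚ) hin)
  · exact h₁ σ (gal_apply_algebraMap_eq_of_isCyclotomicExtension (C := C₁) hr hrm P
      (σ.toAlgHom.restrictScalars ℚ) hin)

end Unramified

/-! ### The compositum of the cubic fields as Hilbert class field -/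

section HilbertClassField

/-- A `K`-automorphism of a compositum of `K` and `E` that fixes `E` is trivial. -/
theorem IntermediateField.algEquiv_extendScalars_eq_one {k Ω : Type*} [Field k] [Field Ω]
    [Algebra k Ω] {K E M : IntermediateField k Ω} (hK : K ≤ M) (hE : E ≤ M) (hM : K ⊔ E = M)
    (σ : Gal(extendScalars hK/K))
    (hσ : ∀ x : E, σ (inclusion hE x : M) = (inclusion hE x : M)) : σ = 1 := by
  let L : IntermediateField k Ω := (lift (fixedField (Subgroup.zpowers σ))).restrictScalars k
  have hfix (z : extendScalars hK) : (z : Ω) ∈ L ↔ σ z = z := by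
    refine (mem_lift z).trans ?_
    rw [mem_fixedField_iff]
    refine ⟨fun h => h σ (Subgroup.mem_zpowers σ), fun h τ hτ => ?_⟩
    have : Subgroup.zpowers σ ≤ MulAction.stabilizer Gal(extendScalars hK/K) z :=
      Subgroup.zpowers_le.mpr h
    exact this hτ
  have hML : M ≤ L := by
    rw [← hM]
    refine sup_le (fun x hx => ?_) fun x hx => ?_
    · exact (hfix ⟨x, hK hx⟩).mpr (σ.commutes ⟨x, hx⟩)
    · exact (hfix ⟨x, hE hx⟩).mpr (hσ ⟨x, hx⟩)
  exact AlgEquiv.ext fun z => (hfix z).mp (hML z.2)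

/-- A cubic field `K` of class number three, whose composita with the cubic subfields of `ℚ(ζ_p)` and
of `ℚ(ζ_q)` both equal the compositum of these two, has that compositum as Hilbert class field. -/
theorem IsCubicSubfield.exists_isHilbertClassField {p q : ℕ} (hp : p.Prime) (hq : q.Prime)
    (hpq : p ≠ q) {K₁ K₂ : IntermediateField ℚ ℂ} (h₁ : IsCubicSubfield (cyclotomicSubfield p) K₁)
    (h₂ : IsCubicSubfield (cyclotomicSubfield q) K₂)
    (h₉ : Module.finrank ℚ ↥(K₁ ⊔ K₂) = 9) {K : IntermediateField ℚ ℂ} [NumberField K]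
    (hK : Module.finrank ℚ K = 3) (hKK₁ : K ⊔ K₁ = K₁ ⊔ K₂) (hKK₂ : K ⊔ K₂ = K₁ ⊔ K₂)
    (hcl : NumberField.classNumber K = 3) :
    ∃ H : IntermediateField K ℂ, IsHilbertClassField K H ∧
      H.restrictScalars ℚ = K₁ ⊔ K₂ ∧ IsAbelianGalois ℚ H := by
  have : NeZero p := ⟨hp.ne_zero⟩
  have : NeZero q := ⟨hq.ne_zero⟩
  have hle : K ≤ K₁ ⊔ K₂ := le_sup_left.trans hKK₁.le
  have hleF : K₁ ⊔ K₂ ≤ cyclotomicSubfield (p * q) :=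
    sup_le (h₁.1.trans (cyclotomicSubfield_le (NeZero.ne _) (dvd_mul_right p q)))
      (h₂.1.trans (cyclotomicSubfield_le (NeZero.ne _) (dvd_mul_left q p)))
  let H : IntermediateField K ℂ := IntermediateField.extendScalars hle
  let ι : H →+* cyclotomicSubfield (p * q) := (IntermediateField.inclusion hleF).toRingHom
  have hab : IsAbelianGalois ℚ H := IsAbelianGalois.of_algHom ι.toRatAlgHom
  have hfin : Module.Finite ℚ H :=
    Module.Finite.of_injective ι.toRatAlgHom.toLinearMap ι.injective
  have : NumberField H := { to_finiteDimensional := hfin }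
  have habK : IsAbelianGalois K H := IsAbelianGalois.tower_top ℚ K H
  have hfr : Module.finrank K H = 3 := by
    have h := Module.finrank_mul_finrank ℚ K H
    -- `H` has the same elements as `K₁ ⊔ K₂`; only its base field is `K`.
    have h9 : Module.finrank ℚ H = 9 := h₉
    rw [hK, h9] at h
    omega
  have hgal {E : IntermediateField ℚ ℂ} (hE : E ≤ cyclotomicSubfield (p * q)) :
      NumberField E ∧ IsGalois ℚ E := by
    let f : E →ₐ[ℚ] cyclotomicSubfield (p * q) :=
      (IntermediateField.inclusion hE).toRingHom.toRatAlgHom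
    exact ⟨{ to_finiteDimensional := Module.Finite.of_injective f.toLinearMap f.injective },
      (IsAbelianGalois.of_algHom f).toIsGalois⟩
  obtain ⟨_, _⟩ := hgal (le_sup_left.trans hleF)
  obtain ⟨_, _⟩ := hgal (le_sup_right.trans hleF)
  let _ : Algebra K₁ H :=
    (IntermediateField.inclusion (le_sup_left : K₁ ≤ K₁ ⊔ K₂)).toRingHom.toAlgebra
  let _ : Algebra K₂ H :=
    (IntermediateField.inclusion (le_sup_right : K₂ ≤ K₁ ⊔ K₂)).toRingHom.toAlgebra
  let _ : Algebra K₁ (cyclotomicSubfield p) :=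
    (IntermediateField.inclusion h₁.1).toRingHom.toAlgebra
  let _ : Algebra K₂ (cyclotomicSubfield q) :=
    (IntermediateField.inclusion h₂.1).toRingHom.toAlgebra
  have hunr : IsUnramifiedAbelianExtension K H :=
    { finite := Module.Finite.right ℚ K H
      abelian := habK
      unramified_finite := isUnramifiedIn_of_forall_fixes (E₁ := K₁) (E₂ := K₂)
        (C₁ := cyclotomicSubfield p) (C₂ := cyclotomicSubfield q)
        ((Nat.coprime_primes hp hq).mpr hpq)
        (fun σ hσ => IntermediateField.algEquiv_extendScalars_eq_one hle le_sup_left hKK₁ σ hσ)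
        (fun σ hσ => IntermediateField.algEquiv_extendScalars_eq_one hle le_sup_right hKK₂ σ hσ)
      -- Ramification at an infinite place would give a stabiliser of order 2, impossible in degree
      -- 3.
      unramified_infinite := IsUnramifiedAtInfinitePlaces_of_odd_finrank (by rw [hfr]; decide) }
  exact ⟨H, isHilbertClassField_of_finrank_eq_classNumber Nat.prime_three hunr hfr hcl, rfl, hab⟩

end HilbertClassField

/-! ### Assembly for `ℚ(ζ_pq)` -/

theorem ZMod.three_dvd_card_units {p : ℕ} (hp : p.Prime) (h : p ≡ 1 [MOD 3]) :
    3 ∣ Nat.card (ZMod p)ˣ := by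
  have := Fact.mk hp
  rw [Nat.card_eq_fintype_card, ZMod.card_units]
  exact (Nat.modEq_iff_dvd' hp.one_le).mp h.symm

theorem lemma5p1 (p q : ℕ) (hp : p.Prime) (hq : q.Prime) (hpq : p ≠ q)
    (hp3 : p ≡ 1 [MOD 3]) (hq3 : q ≡ 1 [MOD 3]) :
    {K | IsCubicSubfield (cyclotomicSubfield (p * q)) K}.ncard = 4 ∧
    {K | IsCubicSubfield (cyclotomicSubfield (p * q)) K ∧
      ¬ K ≤ cyclotomicSubfield p ∧ ¬ K ≤ cyclotomicSubfield q}.ncard = 2 ∧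
    ∃ K₁ K₂ : IntermediateField ℚ ℂ,
      {K | IsCubicSubfield (cyclotomicSubfield p) K} = {K₁} ∧
      {K | IsCubicSubfield (cyclotomicSubfield q) K} = {K₂} ∧
      ∀ (K : IntermediateField ℚ ℂ) [NumberField K],
        IsCubicSubfield (cyclotomicSubfield (p * q)) K →
        ¬ K ≤ cyclotomicSubfield p → ¬ K ≤ cyclotomicSubfield q →
        NumberField.classNumber K = 3 →
        ∃ H : IntermediateField K ℂ, IsHilbertClassField K H ∧
          H.restrictScalars ℚ = K₁ ⊔ K₂ ∧ IsAbelianGalois ℚ H := by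
  have := Fact.mk hp
  have := Fact.mk hq
  obtain ⟨e, N, N', hN, hN', hNp, hNq⟩ :=
    exists_cyclotomicGalEquiv_prod ((Nat.coprime_primes hp hq).mpr hpq)
  obtain ⟨h4, h2, K₁, K₂, hK₁, hK₂, h9, h⟩ := exists_cubic_subfields
    (ZMod.three_dvd_card_units hp hp3) (ZMod.three_dvd_card_units hq hq3) e hN hN'
  rw [hNp] at h2 hK₁ h
  rw [hNq] at h2 hK₂ h
  refine ⟨h4, h2, K₁, K₂, hK₁, hK₂, fun K _ hK hKp hKq hcl => ?_⟩
  have h₁ : IsCubicSubfield (cyclotomicSubfield p) K₁ := (Set.ext_iff.mp hK₁ K₁).mpr rfl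
  have h₂ : IsCubicSubfield (cyclotomicSubfield q) K₂ := (Set.ext_iff.mp hK₂ K₂).mpr rfl
  obtain ⟨hs₁, hs₂⟩ := h K hK hKp hKq
  exact h₁.exists_isHilbertClassField hp hq hpq h₂ h9 hK.2 hs₁ hs₂ hcl
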